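/- Let $\Omega\subset\mathbb R^d$ be a bounded open set, let $T>0$ and let $f\in L^2(\Omega\times(0,T))$. Let $$H_\Delta(\Omega)=\{w\in H^1_0(\Omega) : \Delta w\in L^2(\Omega)\},$$ where $\Delta$ is the weak Laplacian in the spatial variables, and let $$\mathcal V_0=\bigl\{v\in L^2((0,T);H_\Delta(\Omega))\cap H^1((0,T);L^2(\Omega)) : v=0 \text{ on } \Omega\times\{0\}\bigr\},$$ where the initial condition means that the representative of $v$ in $C([0,T];L^2(\Omega))$ vanishes at $t=0$. For $v,w\in\mathcal V_0$ put $$\mathcal A(v,w)=\int_0^T\!\!\int_\Omega\bigl(\partial_t v\,\partial_t w+\Delta v\,\Delta w-\partial_t v\,\Delta w-\Delta v\,\partial_t w\bigr)\,d\Omega\,dt,\qquad \mathcal F(w)=\int_0^T\!\!\int_\Omega f\,(\partial_t w-\Delta w)\,d\Omega\,dt .$$ Consider the minimization problem: find $u\in\mathcal V_0$ such that $$\tfrac12\|\partial_t u-\Delta u-f\|^2_{L^2(\Omega\times(0,T))}\le \tfrac12\|\partial_t v-\Delta v-f\|^2_{L^2(\Omega\times(0,T))}\qquad\text{for all } v\in\mathcal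 V_0,\tag{M}$$ and the variational problem: find $u\in\mathcal V_0$ such that $$\mathcal A(u,v)=\mathcal F(v)\qquad\text{for all } v\in\mathcal V_0.\tag{E}$$ Then (M) and (E) are equivalent, that is, $u$ solves (M) if and only if $u$ solves (E); and each of them has exactly one solution $u\in\mathcal V_0$. -/

import Mathlib

open MeasureTheory Set Filter Topology
open scoped ContDiff Gradient Laplacian

namespace HeatLS

noncomputable section

/-- The Euclidean space `ℝᵈ`. -/
abbrev Space (d : ℕ) : Type := EuclideanSpace ℝ (Fin d)

/-- `φ ∈ C_c^∞(U)`, for an open set `U` of a normed space. -/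
def IsTestFunction {V : Type*} [NormedAddCommGroup V] [NormedSpace ℝ V]
    (U : Set V) (φ : V → ℝ) : Prop :=
  ContDiff ℝ ∞ φ ∧ HasCompactSupport φ ∧ tsupport φ ⊆ U

/-! ### Function spaces on the spatial domain -/

/-- `G` is the weak gradient of `w` on `Ω`. -/
def IsWeakGradient {d : ℕ} (Ω : Set (Space d)) (w : Space d → ℝ)
    (G : Space d → Space d) : Prop :=
  ∀ φ : Space d → ℝ, IsTestFunction Ω φ →
    ∫ x in Ω, w x • gradient φ x = - ∫ x in Ω, φ x • G x

/-- `z` is the weak Laplacian of `w` on `Ω`. -/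
def IsWeakLaplacian {d : ℕ} (Ω : Set (Space d)) (w z : Space d → ℝ) : Prop :=
  ∀ φ : Space d → ℝ, IsTestFunction Ω φ →
    ∫ x in Ω, w x * (Δ φ) x = ∫ x in Ω, z x * φ x

/-- `w ∈ H₀¹(Ω)`: `w` lies in `H¹(Ω)` and is a limit, in the norm of `H¹(Ω)`, of functions
in `C_c^∞(Ω)`. -/
def MemH01 {d : ℕ} (Ω : Set (Space d)) (w : Space d → ℝ) : Prop :=
  MemLp w 2 (volume.restrict Ω) ∧
  ∃ G : Space d → Space d, MemLp G 2 (volume.restrict Ω) ∧ IsWeakGradient Ω w G ∧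
    ∃ φ : ℕ → Space d → ℝ, (∀ n, IsTestFunction Ω (φ n)) ∧
      Tendsto (fun n => eLpNorm (φ n - w) 2 (volume.restrict Ω)) atTop (𝓝 0) ∧
      Tendsto (fun n => eLpNorm (gradient (φ n) - G) 2 (volume.restrict Ω)) atTop (𝓝 0)

/-- `w ∈ H_Δ(Ω) = {w ∈ H₀¹(Ω) : Δ w ∈ L²(Ω)}`. -/
def MemHDelta {d : ℕ} (Ω : Set (Space d)) (w : Space d → ℝ) : Prop :=
  MemH01 Ω w ∧
  ∃ z : Space d → ℝ, MemLp z 2 (volume.restrict Ω) ∧ IsWeakLaplacian Ω w z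

/-! ### Function spaces on the space-time cylinder -/

/-- The open space-time cylinder `Ω × (0, T)`. -/
def cylinder {d : ℕ} (Ω : Set (Space d)) (T : ℝ) : Set (Space d × ℝ) := Ω ×ˢ Ioo 0 T

/-- The space `L²(Ω × (0, T))`. -/
abbrev L2Cyl {d : ℕ} (Ω : Set (Space d)) (T : ℝ) : Type :=
  Lp ℝ 2 ((volume : Measure (Space d × ℝ)).restrict (cylinder Ω T))

/-- The function `v(·, t)` on `Ω`. -/
def slice {d : ℕ} {Ω : Set (Space d)} {T : ℝ} (v : L2Cyl Ω T) (t : ℝ) : Space d → ℝ :=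
  fun x => v (x, t)

/-- `g` is the weak time derivative of `v` on `Ω × (0, T)`. -/
def IsTimeDeriv {d : ℕ} {Ω : Set (Space d)} {T : ℝ} (v g : L2Cyl Ω T) : Prop :=
  ∀ φ : Space d × ℝ → ℝ, IsTestFunction (cylinder Ω T) φ →
    ∫ p in cylinder Ω T, v p * deriv (fun s => φ (p.1, s)) p.2 =
      - ∫ p in cylinder Ω T, g p * φ p

/-- `z` is the Laplacian of `v` in the spatial variables: `z(·, t) = Δ v(·, t)` weakly in `Ω`,
for almost every `t ∈ (0, T)`. -/
def IsSpaceLaplacian {d : ℕ} {Ω : Set (Space d)} {T : ℝ} (v z : L2Cyl Ω T) : Prop :=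
  ∀ᵐ t ∂(volume.restrict (Ioo 0 T)), IsWeakLaplacian Ω (slice v t) (slice z t)

/-- `v ∈ H_Δ(Ω) ⊗ L²(0, T) = L²((0, T); H_Δ(Ω))`: almost every `v(·, t)` is in `H_Δ(Ω)`, and
`Δ v`, formed for almost every `t`, is a function in `L²(Ω × (0, T))`. -/
def MemL2HDelta {d : ℕ} {Ω : Set (Space d)} {T : ℝ} (v : L2Cyl Ω T) : Prop :=
  (∀ᵐ t ∂(volume.restrict (Ioo 0 T)), MemHDelta Ω (slice v t)) ∧
  ∃ z : L2Cyl Ω T, IsSpaceLaplacian v z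

/-- `v ∈ L²(Ω) ⊗ H¹(0, T) = H¹((0, T); L²(Ω))`. -/
def MemH1L2 {d : ℕ} {Ω : Set (Space d)} {T : ℝ} (v : L2Cyl Ω T) : Prop :=
  ∃ g : L2Cyl Ω T, IsTimeDeriv v g

/-- `v = 0` on `Ω × {0}`: the representative of `v` in `C([0, T]; L²(Ω))` vanishes at `t = 0`. -/
def HasZeroInitialValue {d : ℕ} {Ω : Set (Space d)} {T : ℝ} (v : L2Cyl Ω T) : Prop :=
  ∃ c : ℝ → Lp ℝ 2 ((volume : Measure (Space d)).restrict Ω),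
    ContinuousOn c (Icc 0 T) ∧
    (∀ᵐ t ∂(volume.restrict (Ioo 0 T)), slice v t =ᵐ[volume.restrict Ω] c t) ∧
    c 0 = 0

/-- The space `V₀`. -/
def V0 {d : ℕ} (Ω : Set (Space d)) (T : ℝ) : Set (L2Cyl Ω T) :=
  {v | MemL2HDelta v ∧ MemH1L2 v ∧ HasZeroInitialValue v}

open Classical in
/-- The weak time derivative `∂ₜ v ∈ L²(Ω × (0, T))` (used for `v ∈ V₀`; `0` if there is none). -/
def timeDeriv {d : ℕ} {Ω : Set (Space d)} {T : ℝ} (v : L2Cyl Ω T) : L2Cyl Ω T :=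
  if h : ∃ g : L2Cyl Ω T, IsTimeDeriv v g then h.choose else 0

open Classical in
/-- The spatial Laplacian `Δ v ∈ L²(Ω × (0, T))` (used for `v ∈ V₀`; `0` if there is none). -/
def spaceLaplacian {d : ℕ} {Ω : Set (Space d)} {T : ℝ} (v : L2Cyl Ω T) : L2Cyl Ω T :=
  if h : ∃ z : L2Cyl Ω T, IsSpaceLaplacian v z then h.choose else 0

/-! ### The two problems -/

/-- The least-squares functional `½ ‖∂ₜ v - Δ v - f‖²`, with the norm of `L²(Ω × (0, T))`. -/
def lsFunctional {d : ℕ} {Ω : Set (Space d)} {T : ℝ} (f v : L2Cyl Ω T) : ℝ :=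
  (1 / 2 : ℝ) * ‖timeDeriv v - spaceLaplacian v - f‖ ^ 2

/-- The bilinear form `𝒜(v, w)`. -/
def bilinA {d : ℕ} {Ω : Set (Space d)} {T : ℝ} (v w : L2Cyl Ω T) : ℝ :=
  ∫ t in (0 : ℝ)..T, ∫ x in Ω,
    (timeDeriv v (x, t) * timeDeriv w (x, t)
      + spaceLaplacian v (x, t) * spaceLaplacian w (x, t)
      - timeDeriv v (x, t) * spaceLaplacian w (x, t)
      - spaceLaplacian v (x, t) * timeDeriv w (x, t))

/-- The linear form `ℱ(w)`. -/
def linF {d : ℕ} {Ω : Set (Space d)} {T : ℝ} (f w : L2Cyl Ω T) : ℝ :=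
  ∫ t in (0 : ℝ)..T, ∫ x in Ω,
    f (x, t) * (timeDeriv w (x, t) - spaceLaplacian w (x, t))

/-- `u` solves the minimization problem over `V₀`. -/
def IsLSMinimizer {d : ℕ} {Ω : Set (Space d)} {T : ℝ} (f u : L2Cyl Ω T) : Prop :=
  u ∈ V0 Ω T ∧ ∀ v ∈ V0 Ω T, lsFunctional f u ≤ lsFunctional f v

/-- `u` solves the variational problem in `V₀`. -/
def IsVariationalSolution {d : ℕ} {Ω : Set (Space d)} {T : ℝ} (f u : L2Cyl Ω T) : Prop :=
  u ∈ V0 Ω T ∧ ∀ v ∈ V0 Ω T, bilinA u v = linF f v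

end

end HeatLS

/-! The theorem reduces to one fact: `v ↦ ∂ₜ v - Δ v` is a bijection from `V₀` onto `L²(Ω × (0,
T))`. Write `L` for this map (`heatOperator`). The integrand of `𝒜` factors, so `𝒜(v, w) = ⟪L v, L
w⟫` and `ℱ(w) = ⟪f, L w⟫`. If `L` is onto, the minimum in (M) is zero, and (E) may be tested with
some `v` for which `L v = L u - f`. Hence each problem says exactly `L u = f` (`isLSMinimizer_iff`,
`isVariationalSolution_iff`).

For bijectivity the unknown `u` is replaced by the pair `g = ∂ₜ u`, `z = -Δ u`. In `X = L²((0, T);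
L²(Ω))` let `J` be integration from `0` (`volterra`) and `S` the inverse Dirichlet Laplacian acting
at each time (`timeDirichletInverse`). For `d > 0`, `u ∈ V₀` with these derivatives means `u = J g =
S z`, and the heat equation becomes: find `g`, `z` with `J g = S z` and `g + z = f`.

The operators commute, `S` is symmetric, nonnegative and injective, and integration by parts gives
`2⟪J y, y⟫ = ‖∫ y‖²` and `2⟪S y, J y⟫ = ⟪S ∫ y, ∫ y⟫`, both nonnegative. The first makes the range
of `S + J` dense, the second gives `‖S h‖² + ‖J h‖² ≤ ‖(S + J) h‖²`. If `(S + J) hₙ → f`, then `S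
hₙ` and `J hₙ` converge separately, and their limits are `g` and `z` (`exists_add_eq_of_commute`).
No regularity of `∂Ω` enters. -/

open MeasureTheory Set Filter Topology
open scoped ContDiff Gradient Laplacian

namespace HeatLS

noncomputable section

/-! ### Sums of commuting accretive operators -/

section Abstract

variable {X : Type*} [NormedAddCommGroup X] [InnerProductSpace ℝ X]

/-- The cross term of the expanded square is nonnegative. This is the maximal regularity estimate:
`S` and `J` are each controlled by their sum. -/
theorem norm_sq_add_norm_sq_le_of_inner_nonneg {S J : X →L[ℝ] X}
    (hSJ : ∀ x, 0 ≤ inner ℝ (S x) (J x)) (x : X) :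
    ‖S x‖ ^ 2 + ‖J x‖ ^ 2 ≤ ‖(S + J) x‖ ^ 2 := by
  rw [add_apply, norm_add_sq_real]
  linarith [hSJ x]

/-- A vector `x` orthogonal to the range is orthogonal to `(S + J) x`, so `⟪S x, x⟫ = -⟪J x, x⟫ ≤
0`. The hypothesis on `S` packs positivity and injectivity into one implication. -/
theorem denseRange_add_of_accretive [CompleteSpace X] {S J : X →L[ℝ] X}
    (hS : ∀ x, inner ℝ (S x) x ≤ 0 → x = 0) (hJ : ∀ x, 0 ≤ inner ℝ (J x) x) :
    DenseRange (S + J) := by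
  have h : (LinearMap.range (S + J).toLinearMap).topologicalClosure = ⊤ := by
    rw [Submodule.topologicalClosure_eq_top_iff, Submodule.eq_bot_iff]
    intro x hx
    have h := (Submodule.mem_orthogonal _ _).1 hx ((S + J) x) ⟨x, rfl⟩
    rw [add_apply, inner_add_left] at h
    exact hS x (by linarith [hJ x])
  intro x
  have hx : x ∈ (LinearMap.range (S + J).toLinearMap).topologicalClosure := h ▸ Submodule.mem_top
  exact hx

/-- For commuting accretive operators `S`, `J` with `⟪S x, J x⟫ ≥ 0`, the equation
`S⁻¹ v + J⁻¹ v = f` is solvable for every `f`. -/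
theorem exists_add_eq_of_commute [CompleteSpace X] {S J : X →L[ℝ] X}
    (hcomm : ∀ x, S (J x) = J (S x))
    (hS : ∀ x, inner ℝ (S x) x ≤ 0 → x = 0) (hJ : ∀ x, 0 ≤ inner ℝ (J x) x)
    (hSJ : ∀ x, 0 ≤ inner ℝ (S x) (J x)) (f : X) :
    ∃ g z : X, J g = S z ∧ g + z = f := by
  -- The range of `S + J` need not be closed and the `h n` below need not converge; only `S (h n)`
  -- and `J (h n)` do.
  obtain ⟨w, hw⟩ := mem_closure_iff_seq_limit.1 (denseRange_add_of_accretive hS hJ f)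
  obtain ⟨h, hh⟩ : ∃ h : ℕ → X, ∀ n, (S + J) (h n) = w n :=
    ⟨fun n => (hw.1 n).choose, fun n => (hw.1 n).choose_spec⟩
  have hlim : Tendsto (fun n => (S + J) (h n)) atTop (𝓝 f) := by simpa only [hh] using hw.2
  have hc := hlim.cauchySeq
  have key : ∀ A : X →L[ℝ] X, (∀ x, ‖A x‖ ≤ ‖(S + J) x‖) → CauchySeq fun n => A (h n) := by
    intro A hA
    rw [Metric.cauchySeq_iff] at hc ⊢
    intro ε hε
    obtain ⟨N, hN⟩ := hc ε hε
    refine ⟨N, fun m hm n hn => lt_of_le_of_lt ?_ (hN m hm n hn)⟩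
    rw [dist_eq_norm, dist_eq_norm, ← map_sub, ← map_sub]
    exact hA _
  have hSn : ∀ x, ‖S x‖ ≤ ‖(S + J) x‖ := fun x => by
    rw [← sq_le_sq₀ (norm_nonneg _) (norm_nonneg _)]
    linarith [norm_sq_add_norm_sq_le_of_inner_nonneg hSJ x, sq_nonneg ‖J x‖]
  have hJn : ∀ x, ‖J x‖ ≤ ‖(S + J) x‖ := fun x => by
    rw [← sq_le_sq₀ (norm_nonneg _) (norm_nonneg _)]
    linarith [norm_sq_add_norm_sq_le_of_inner_nonneg hSJ x, sq_nonneg ‖S x‖]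
  obtain ⟨g, hg⟩ := cauchySeq_tendsto_of_complete (key S hSn)
  obtain ⟨z, hz⟩ := cauchySeq_tendsto_of_complete (key J hJn)
  refine ⟨g, z, ?_, tendsto_nhds_unique (hg.add hz) hlim⟩
  -- `J (S (h n)) = S (J (h n))` passes to the limit.
  refine tendsto_nhds_unique ((J.continuous.tendsto _).comp hg) ?_
  refine ((S.continuous.tendsto _).comp hz).congr fun n => ?_
  simp [hcomm]

/-- Pairing `J g = -S g` with `g` gives `⟪S g, g⟫ = -⟪J g, g⟫ ≤ 0`. -/
theorem eq_zero_of_add_eq_zero {S J : X →L[ℝ] X}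
    (hS : ∀ x, inner ℝ (S x) x ≤ 0 → x = 0) (hJ : ∀ x, 0 ≤ inner ℝ (J x) x)
    {g z : X} (h : J g = S z) (hgz : g + z = 0) : g = 0 := by
  obtain rfl : z = -g := eq_neg_of_add_eq_zero_right hgz
  have := hJ g
  rw [h, map_neg, inner_neg_left] at this
  exact hS g (by linarith)

end Abstract

/-! ### The identification of `L²(α × β)` with `L²(β; L²(α))` -/

section Slices

/-- In a second countable space an open set is a countable union of balls. This reduces
measurability of an `L²`-valued map to that of scalar integrals. -/
theorem measurable_of_measurable_dist {β H : Type*} [MeasurableSpace β] [PseudoMetricSpace H]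
    [SecondCountableTopology H] [MeasurableSpace H] [BorelSpace H] {y : β → H}
    (hy : ∀ a, Measurable fun t => dist (y t) a) : Measurable y := by
  refine measurable_of_isOpen fun s hs => ?_
  obtain ⟨r, hr⟩ : ∃ r : s → ℝ, ∀ a : s, 0 < r a ∧ Metric.ball (a : H) (r a) ⊆ s :=
    ⟨fun a => (Metric.isOpen_iff.1 hs a a.2).choose,
      fun a => (Metric.isOpen_iff.1 hs a a.2).choose_spec⟩
  obtain ⟨A, hA, hAs⟩ := TopologicalSpace.isOpen_iUnion_countable
    (fun a : s => Metric.ball (a : H) (r a)) fun _ => Metric.isOpen_ball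
  have hs' : s = ⋃ a ∈ A, Metric.ball (a : H) (r a) := by
    rw [hAs]
    refine Subset.antisymm (fun x hx => mem_iUnion.2 ⟨⟨x, hx⟩, ?_⟩) (iUnion_subset fun a => (hr a).2)
    exact Metric.mem_ball_self (hr _).1
  rw [hs', preimage_iUnion₂]
  exact MeasurableSet.biUnion hA fun a _ => measurableSet_lt (hy a) measurable_const

variable {α β : Type*} [MeasurableSpace α] [MeasurableSpace β] {μ : Measure α} {ν : Measure β}

theorem lintegral_enorm_sq_eq_eLpNorm_sq {E : Type*} [NormedAddCommGroup E] {f : α → E} :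
    ∫⁻ x, ‖f x‖ₑ ^ (2 : ℝ) ∂μ = eLpNorm f 2 μ ^ (2 : ℝ) := by
  rw [eLpNorm_eq_lintegral_rpow_enorm_toReal (by norm_num) (by norm_num)]
  rw [← ENNReal.rpow_mul]
  norm_num

theorem memLp_two_iff_lintegral {E : Type*} [NormedAddCommGroup E] {f : α → E}
    (hf : AEStronglyMeasurable f μ) :
    MemLp f 2 μ ↔ ∫⁻ x, ‖f x‖ₑ ^ (2 : ℝ) ∂μ < ⊤ := by
  rw [lintegral_enorm_sq_eq_eLpNorm_sq, ENNReal.rpow_lt_top_iff_of_pos (by norm_num)]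
  exact ⟨fun h => h.2, fun h => ⟨hf, h⟩⟩

variable [SigmaFinite μ] [SigmaFinite ν]

theorem measurable_toLp_slice [IsSeparable μ] {F : α × β → ℝ} (hF : Measurable F)
    (h : ∀ t, MemLp (fun x => F (x, t)) 2 μ) :
    StronglyMeasurable fun t => (h t).toLp := by
  have : Fact ((2 : ENNReal) ≠ ⊤) := ⟨by norm_num⟩
  borelize ↥(Lp ℝ 2 μ)
  refine Measurable.stronglyMeasurable (measurable_of_measurable_dist fun a => ?_)
  have h1 : ∀ t, dist ((h t).toLp) a
      = ((∫⁻ x, ‖F (x, t) - a x‖ₑ ^ (2 : ℝ) ∂μ) ^ (1 / 2 : ℝ)).toReal := by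
    intro t
    have h2 : ((h t).toLp : α → ℝ) - (a : α → ℝ) =ᵐ[μ] fun x => F (x, t) - a x := by
      filter_upwards [(h t).coeFn_toLp] with x hx
      simp [hx]
    rw [Lp.dist_def, eLpNorm_congr_ae h2,
      eLpNorm_eq_lintegral_rpow_enorm_toReal (by norm_num) (by norm_num)]
    simp
  simp_rw [h1]
  have ha : Measurable a := (Lp.stronglyMeasurable a).measurable
  refine ((Measurable.lintegral_prod_left' (f := fun p : α × β => ‖F p - a p.1‖ₑ ^ (2 : ℝ))
    ?_).pow_const _).ennreal_toReal
  fun_prop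

theorem exists_Lp_slice [IsSeparable μ] (v : Lp ℝ 2 (μ.prod ν)) :
    ∃ y : Lp (Lp ℝ 2 μ) 2 ν, ∀ᵐ t ∂ν, (fun x => v (x, t)) =ᵐ[μ] y t := by
  have hv : Measurable v := (Lp.stronglyMeasurable v).measurable
  have hm : Measurable fun t => ∫⁻ x, ‖v (x, t)‖ₑ ^ (2 : ℝ) ∂μ :=
    Measurable.lintegral_prod_left' (f := fun p : α × β => ‖v p‖ₑ ^ (2 : ℝ)) (by fun_prop)
  have htot : ∫⁻ t, ∫⁻ x, ‖v (x, t)‖ₑ ^ (2 : ℝ) ∂μ ∂ν < ⊤ := by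
    rw [← lintegral_prod_symm (fun p : α × β => ‖v p‖ₑ ^ (2 : ℝ)) (by fun_prop)]
    exact (memLp_two_iff_lintegral (Lp.aestronglyMeasurable v)).1 (Lp.memLp v)
  let N : Set β := {t | ∫⁻ x, ‖v (x, t)‖ₑ ^ (2 : ℝ) ∂μ < ⊤}
  have hN : MeasurableSet N := measurableSet_lt hm measurable_const
  have hNae : ∀ᵐ t ∂ν, t ∈ N := ae_lt_top hm htot.ne
  -- By Tonelli almost every slice is square integrable; the exceptional ones are replaced by zero
  -- so that `t ↦ F(·, t)` takes values in `L²` for every `t`.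
  let F : α × β → ℝ := indicator (univ ×ˢ N) v
  have hF : Measurable F := hv.indicator (MeasurableSet.univ.prod hN)
  have hFN : ∀ t ∈ N, (fun x => F (x, t)) = fun x => v (x, t) := fun t ht => by
    ext x; exact indicator_of_mem (by simpa using ht) _
  have hFN' : ∀ t, t ∉ N → (fun x => F (x, t)) = 0 := fun t ht => by
    ext x; exact indicator_of_notMem (by simpa using ht) _
  have hmem : ∀ t, MemLp (fun x => F (x, t)) 2 μ := fun t => by
    by_cases ht : t ∈ N
    · rw [hFN t ht]
      exact (memLp_two_iff_lintegral (hv.comp measurable_prodMk_right).aestronglyMeasurable).2 ht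
    · rw [hFN' t ht]; exact MemLp.zero
  have hy : MemLp (fun t => (hmem t).toLp) 2 ν := by
    rw [memLp_two_iff_lintegral (measurable_toLp_slice hF hmem).aestronglyMeasurable]
    refine lt_of_le_of_lt (lintegral_mono_ae ?_) htot
    filter_upwards [hNae] with t ht
    rw [Lp.enorm_toLp, hFN t ht, ← lintegral_enorm_sq_eq_eLpNorm_sq]
  refine ⟨hy.toLp, ?_⟩
  filter_upwards [hNae, hy.coeFn_toLp] with t ht h
  rw [h]
  filter_upwards [(hmem t).coeFn_toLp] with x hx
  exact (congrFun (hFN t ht) x).symm.trans hx.symm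

theorem ae_ae_of_ae_prod_symm {P : α × β → Prop} (h : ∀ᵐ p ∂μ.prod ν, P p) :
    ∀ᵐ t ∂ν, ∀ᵐ x ∂μ, P (x, t) := by
  rw [← Measure.prod_swap] at h
  exact Measure.ae_ae_of_ae_prod (ae_of_ae_map measurable_swap.aemeasurable h)

variable {π : Measure (α × β)}

/-- The measure `π` is kept apart from `μ.prod ν` because Lebesgue measure restricted to the
cylinder is a product only through a proved equation. -/
theorem ae_eq_slice_of_ae_eq (hπ : π = μ.prod ν) {v w : α × β → ℝ} (h : v =ᵐ[π] w) :
    ∀ᵐ t ∂ν, (fun x => v (x, t)) =ᵐ[μ] fun x => w (x, t) := by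
  subst hπ
  exact ae_ae_of_ae_prod_symm h

/-- The function `t ↦ v(·, t)`, as an element of `L²(β; L²(α))`. -/
def sliceFun [IsSeparable μ] (hπ : π = μ.prod ν) (v : Lp ℝ 2 π) : Lp (Lp ℝ 2 μ) 2 ν :=
  (exists_Lp_slice (hπ ▸ v : Lp ℝ 2 (μ.prod ν))).choose

theorem sliceFun_spec [IsSeparable μ] (hπ : π = μ.prod ν) (v : Lp ℝ 2 π) :
    ∀ᵐ t ∂ν, (fun x => v (x, t)) =ᵐ[μ] sliceFun hπ v t := by
  subst hπ
  exact (exists_Lp_slice v).choose_spec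

theorem sliceFun_eq_of_ae [IsSeparable μ] (hπ : π = μ.prod ν) {v : Lp ℝ 2 π}
    {y : Lp (Lp ℝ 2 μ) 2 ν} (h : ∀ᵐ t ∂ν, (fun x => v (x, t)) =ᵐ[μ] y t) : sliceFun hπ v = y := by
  refine Lp.ext ?_
  filter_upwards [h, sliceFun_spec hπ v] with t h1 h2
  exact Lp.ext (h2.symm.trans h1)

theorem norm_sliceFun [IsSeparable μ] (hπ : π = μ.prod ν) (v : Lp ℝ 2 π) :
    ‖sliceFun hπ v‖ = ‖v‖ := by
  rw [Lp.norm_def, Lp.norm_def]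
  congr 1
  have h2 : Function.Injective fun a : ENNReal => a ^ (2 : ℝ) :=
    ENNReal.rpow_left_injective (by norm_num)
  apply h2
  have hv : Measurable v := (Lp.stronglyMeasurable v).measurable
  simp only [← lintegral_enorm_sq_eq_eLpNorm_sq]
  have h3 := sliceFun_spec hπ v
  rw [show ∫⁻ p, ‖v p‖ₑ ^ (2 : ℝ) ∂π = ∫⁻ p, ‖v p‖ₑ ^ (2 : ℝ) ∂(μ.prod ν) by rw [← hπ],
    lintegral_prod_symm (fun p : α × β => ‖v p‖ₑ ^ (2 : ℝ)) (by fun_prop)]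
  refine lintegral_congr_ae ?_
  filter_upwards [h3] with t ht
  rw [lintegral_enorm_sq_eq_eLpNorm_sq, eLpNorm_congr_ae ht, Lp.enorm_def]

/-- `v ↦ (t ↦ v(·, t))` as a linear isometry. -/
def sliceIsometry [IsSeparable μ] (hπ : π = μ.prod ν) :
    Lp ℝ 2 π →ₗᵢ[ℝ] Lp (Lp ℝ 2 μ) 2 ν where
  toFun := sliceFun hπ
  map_add' v w := by
    refine sliceFun_eq_of_ae hπ ?_
    filter_upwards [sliceFun_spec hπ v, sliceFun_spec hπ w, ae_eq_slice_of_ae_eq hπ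
      (Lp.coeFn_add v w), Lp.coeFn_add (sliceFun hπ v) (sliceFun hπ w)] with t h1 h2 h3 h4
    rw [h4]
    exact h3.trans ((h1.add h2).trans (Lp.coeFn_add _ _).symm)
  map_smul' c v := by
    refine sliceFun_eq_of_ae hπ ?_
    filter_upwards [sliceFun_spec hπ v, ae_eq_slice_of_ae_eq hπ
      (Lp.coeFn_smul c v), Lp.coeFn_smul c (sliceFun hπ v)] with t h1 h3 h4
    rw [RingHom.id_apply, h4]
    exact h3.trans ((h1.const_smul c).trans (Lp.coeFn_smul _ _).symm)
  norm_map' := norm_sliceFun hπ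

/-- The range of an isometry of a complete space is closed, so it suffices to reach the functions
`1_s(t) w`; these come from `1_s(t) w(x)`. -/
theorem surjective_sliceIsometry [IsSeparable μ] (hπ : π = μ.prod ν) :
    Function.Surjective (sliceIsometry hπ) := by
  have hcl : IsClosed (range (sliceIsometry hπ)) := (sliceIsometry hπ).isometry.isClosedEmbedding.isClosed_range
  intro y
  change y ∈ range (sliceIsometry hπ)
  refine Lp.induction (by norm_num) (fun y => y ∈ range (sliceIsometry hπ)) ?_ ?_ hcl y
  · intro w s hs hμs
    have hw : MemLp (fun p : α × β => indicator s (fun _ => (1 : ℝ)) p.2 * w p.1) 2 π := by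
      have hm : Measurable fun p : α × β => indicator s (fun _ => (1 : ℝ)) p.2 * w p.1 :=
        ((measurable_const.indicator hs).comp measurable_snd).mul
          ((Lp.stronglyMeasurable w).measurable.comp measurable_fst)
      subst hπ
      rw [memLp_two_iff_lintegral hm.aestronglyMeasurable,
        lintegral_prod_symm (fun p : α × β => ‖indicator s (fun _ => (1 : ℝ)) p.2 * w p.1‖ₑ ^ (2 : ℝ))
        (by fun_prop)]
      have h1 : ∀ t, ∫⁻ x, ‖indicator s (fun _ => (1 : ℝ)) t * w x‖ₑ ^ (2 : ℝ) ∂μ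
          = indicator s (fun _ => ∫⁻ x, ‖w x‖ₑ ^ (2 : ℝ) ∂μ) t := fun t => by
        by_cases ht : t ∈ s <;> simp [ht]
      simp_rw [h1]
      rw [lintegral_indicator hs, setLIntegral_const]
      exact ENNReal.mul_lt_top ((memLp_two_iff_lintegral (Lp.aestronglyMeasurable w)).1
        (Lp.memLp w)) hμs
    refine ⟨hw.toLp, sliceFun_eq_of_ae hπ ?_⟩
    rw [Lp.simpleFunc.coe_indicatorConst]
    filter_upwards [ae_eq_slice_of_ae_eq hπ hw.coeFn_toLp,
      indicatorConstLp_coeFn (p := 2) (hs := hs) (hμs := hμs.ne) (c := w)] with t h1 h2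
    refine h1.trans ?_
    rw [h2]
    by_cases ht : t ∈ s
    · simp [ht]
    · simp only [ht, not_false_eq_true, indicator_of_notMem, zero_mul]
      exact (Lp.coeFn_zero _ _ _).symm
  · rintro f g hf hg - ⟨v, hv⟩ ⟨w, hw⟩
    exact ⟨v + w, by rw [map_add, hv, hw]⟩

/-- The identification of `L²(α × β)` with `L²(β; L²(α))`. -/
def sliceEquiv [IsSeparable μ] (hπ : π = μ.prod ν) :
    Lp ℝ 2 π ≃ₗᵢ[ℝ] Lp (Lp ℝ 2 μ) 2 ν :=
  LinearIsometryEquiv.ofSurjective (sliceIsometry hπ) (surjective_sliceIsometry hπ)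

theorem sliceEquiv_spec [IsSeparable μ] (hπ : π = μ.prod ν) (v : Lp ℝ 2 π) :
    ∀ᵐ t ∂ν, (fun x => v (x, t)) =ᵐ[μ] sliceEquiv hπ v t :=
  sliceFun_spec hπ v

end Slices

/-! ### The Volterra operator on `L²((0, T); H)` -/

section Volterra

variable {H : Type*} [NormedAddCommGroup H] {T : ℝ}

/-- The space `L²((0, T); H)`. -/
abbrev L2Time (H : Type*) [NormedAddCommGroup H] (T : ℝ) : Type _ :=
  Lp H 2 ((volume : Measure ℝ).restrict (Ioo 0 T))

theorem L2Time.integrableOn (y : L2Time H T) : IntegrableOn y (Ioo 0 T) :=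
  (Lp.memLp y).integrable (by norm_num)

theorem L2Time.intervalIntegrable (y : L2Time H T) {t : ℝ} (ht : t ∈ Icc 0 T) :
    IntervalIntegrable y volume 0 t := by
  rw [intervalIntegrable_iff_integrableOn_Ioo_of_le ht.1]
  exact y.integrableOn.mono_set (Ioo_subset_Ioo_right ht.2)

variable [InnerProductSpace ℝ H]

theorem L2Time.norm_primitive_le (y : L2Time H T) {t : ℝ} (ht : t ∈ Icc 0 T) :
    ‖∫ s in 0..t, y s‖ ≤ √T * ‖y‖ := by
  have hT : 0 ≤ T := ht.1.trans ht.2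
  have h1 : ‖∫ s in 0..t, y s‖ ≤ ∫ s in Ioo 0 T, ‖y s‖ := by
    refine (intervalIntegral.norm_integral_le_integral_norm ht.1).trans ?_
    rw [intervalIntegral.integral_of_le ht.1, integral_Ioc_eq_integral_Ioo]
    exact setIntegral_mono_set y.integrableOn.norm (ae_of_all _ fun s => norm_nonneg _)
      (Ioo_subset_Ioo_right ht.2).eventuallyLE
  refine h1.trans ?_
  -- Hölder on `(0, T)`: passing from `L¹` to `L²` costs `T ^ (1 - 1/2) = √T`.
  have h2 := eLpNorm_le_eLpNorm_mul_rpow_measure_univ (p := 1) (q := 2) (by norm_num)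
    (Lp.aestronglyMeasurable y)
  rw [integral_norm_eq_lintegral_enorm (Lp.aestronglyMeasurable y), ← eLpNorm_one_eq_lintegral_enorm,
    Lp.norm_def, mul_comm]
  refine (ENNReal.toReal_mono ?_ h2).trans_eq ?_
  · refine ENNReal.mul_ne_top (Lp.eLpNorm_ne_top y) (ENNReal.rpow_ne_top_of_nonneg ?_ ?_)
    · norm_num
    · exact measure_ne_top _ _
  · rw [ENNReal.toReal_mul, ← ENNReal.toReal_rpow, Real.sqrt_eq_rpow]
    norm_num [ENNReal.toReal_ofReal hT]

theorem L2Time.continuousOn_primitive (y : L2Time H T) :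
    ContinuousOn (fun t => ∫ s in 0..t, y s) (Icc 0 T) := by
  have h := intervalIntegral.continuousOn_primitive_interval (μ := volume) (f := y) (a := 0) (b := T)
  rcases le_or_gt 0 T with hT | hT
  · rw [uIcc_of_le hT, integrableOn_Icc_iff_integrableOn_Ioo] at h
    exact h y.integrableOn
  · simp [Icc_eq_empty_of_lt hT]

theorem L2Time.memLp_primitive (y : L2Time H T) :
    MemLp (fun t => ∫ s in 0..t, y s) 2 ((volume : Measure ℝ).restrict (Ioo 0 T)) := by
  refine MemLp.of_bound ((y.continuousOn_primitive.mono Ioo_subset_Icc_self).aestronglyMeasurable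
    measurableSet_Ioo) (√T * ‖y‖) ?_
  filter_upwards [ae_restrict_mem measurableSet_Ioo] with t ht
  exact y.norm_primitive_le (Ioo_subset_Icc_self ht)

theorem L2Time.primitive_add (y z : L2Time H T) {t : ℝ} (ht : t ∈ Icc 0 T) :
    ∫ s in 0..t, (y + z) s = (∫ s in 0..t, y s) + ∫ s in 0..t, z s := by
  rw [← intervalIntegral.integral_add (y.intervalIntegrable ht) (z.intervalIntegrable ht)]
  simp only [intervalIntegral.integral_of_le ht.1, integral_Ioc_eq_integral_Ioo]
  exact integral_congr_ae (ae_restrict_of_ae_restrict_of_subset (Ioo_subset_Ioo_right ht.2)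
    (Lp.coeFn_add y z))

theorem L2Time.primitive_smul (c : ℝ) (y : L2Time H T) {t : ℝ} (ht : t ∈ Icc 0 T) :
    ∫ s in 0..t, (c • y) s = c • ∫ s in 0..t, y s := by
  rw [← intervalIntegral.integral_smul]
  simp only [intervalIntegral.integral_of_le ht.1, integral_Ioc_eq_integral_Ioo]
  exact integral_congr_ae (ae_restrict_of_ae_restrict_of_subset (Ioo_subset_Ioo_right ht.2)
    (Lp.coeFn_smul c y))

theorem inner_compLpL_comm {A : H →L[ℝ] H} (hA : ∀ a b, inner ℝ (A a) b = inner ℝ a (A b))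
    (y z : L2Time H T) :
    inner ℝ (A.compLpL 2 ((volume : Measure ℝ).restrict (Ioo 0 T)) y) z
      = inner ℝ y (A.compLpL 2 ((volume : Measure ℝ).restrict (Ioo 0 T)) z) := by
  rw [L2.inner_def, L2.inner_def]
  refine integral_congr_ae ?_
  filter_upwards [A.coeFn_compLpL y, A.coeFn_compLpL z] with t h1 h2
  rw [h1, h2, hA]

theorem eq_zero_of_inner_compLpL_nonpos {A : H →L[ℝ] H} (hA0 : ∀ a, 0 ≤ inner ℝ (A a) a)
    (hA1 : ∀ a, inner ℝ (A a) a = 0 → a = 0) (y : L2Time H T)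
    (hy : inner ℝ (A.compLpL 2 ((volume : Measure ℝ).restrict (Ioo 0 T)) y) y ≤ 0) : y = 0 := by
  have hi := L2.integrable_inner (𝕜 := ℝ) (A.compLpL 2 ((volume : Measure ℝ).restrict (Ioo 0 T)) y) y
  rw [L2.inner_def] at hy
  have hnn : 0 ≤ᵐ[(volume : Measure ℝ).restrict (Ioo 0 T)] fun t =>
      inner ℝ (A.compLpL 2 ((volume : Measure ℝ).restrict (Ioo 0 T)) y t) (y t) := by
    filter_upwards [A.coeFn_compLpL y] with t h1
    rw [h1]; exact hA0 _
  have h0 := (integral_eq_zero_iff_of_nonneg_ae hnn hi).1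
    (le_antisymm hy (integral_nonneg_of_ae hnn))
  rw [Lp.eq_zero_iff_ae_eq_zero]
  filter_upwards [A.coeFn_compLpL y, h0] with t h1 h2
  rw [h1] at h2
  exact hA1 _ h2

/-- The integration operator `y ↦ ∫₀ᵗ y` on `L²((0, T); H)`. -/
def volterra : L2Time H T →L[ℝ] L2Time H T :=
  LinearMap.mkContinuousOfExistsBound
    { toFun := fun y => y.memLp_primitive.toLp
      map_add' := fun y z => by
        rw [← MemLp.toLp_add, MemLp.toLp_eq_toLp_iff]
        filter_upwards [ae_restrict_mem measurableSet_Ioo] with t ht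
        exact L2Time.primitive_add y z (Ioo_subset_Icc_self ht)
      map_smul' := fun c y => by
        rw [RingHom.id_apply, ← MemLp.toLp_const_smul, MemLp.toLp_eq_toLp_iff]
        filter_upwards [ae_restrict_mem measurableSet_Ioo] with t ht
        exact L2Time.primitive_smul c y (Ioo_subset_Icc_self ht) }
    ⟨_, fun y => by
      refine (Lp.norm_le_of_ae_bound (C := √T * ‖y‖) (by positivity) ?_).trans_eq
        (mul_assoc _ _ _).symm
      filter_upwards [ae_restrict_mem measurableSet_Ioo, y.memLp_primitive.coeFn_toLp] with t ht h
      simp only [LinearMap.coe_mk, AddHom.coe_mk]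
      rw [h]
      exact y.norm_primitive_le (Ioo_subset_Icc_self ht)⟩

theorem coeFn_volterra (y : L2Time H T) :
    ∀ᵐ t ∂((volume : Measure ℝ).restrict (Ioo 0 T)), volterra y t = ∫ s in 0..t, y s :=
  y.memLp_primitive.coeFn_toLp

/-- `y ↦ ∫₀ᵀ y` on `L²((0, T); H)`. -/
def totalIntegral (hT : 0 ≤ T) : L2Time H T →L[ℝ] H :=
  LinearMap.mkContinuous
    { toFun := fun y => ∫ s in 0..T, y s
      map_add' := fun y z => L2Time.primitive_add y z ⟨hT, le_rfl⟩
      map_smul' := fun c y => L2Time.primitive_smul c y ⟨hT, le_rfl⟩ }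
    (√T) fun y => y.norm_primitive_le ⟨hT, le_rfl⟩

theorem totalIntegral_apply (hT : 0 ≤ T) (y : L2Time H T) :
    totalIntegral hT y = ∫ s in 0..T, y s := rfl

variable [CompleteSpace H]

/-- The integrand is the derivative of the inner product of the two primitives, which vanishes at
`0`. -/
theorem integral_inner_primitive_add {a b : ℝ → H} (ha : Continuous a) (hb : Continuous b) :
    ∫ t in 0..T, (inner ℝ (∫ s in 0..t, a s) (b t) + inner ℝ (a t) (∫ s in 0..t, b s))
      = inner ℝ (∫ s in 0..T, a s) (∫ s in 0..T, b s) := by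
  have hA : ∀ t, HasDerivAt (fun t => ∫ s in 0..t, a s) (a t) t := fun t =>
    ha.integral_hasStrictDerivAt 0 t |>.hasDerivAt
  have hB : ∀ t, HasDerivAt (fun t => ∫ s in 0..t, b s) (b t) t := fun t =>
    hb.integral_hasStrictDerivAt 0 t |>.hasDerivAt
  have hAc : Continuous fun t => ∫ s in 0..t, a s :=
    continuous_iff_continuousAt.2 fun t => (hA t).continuousAt
  have hBc : Continuous fun t => ∫ s in 0..t, b s :=
    continuous_iff_continuousAt.2 fun t => (hB t).continuousAt
  rw [intervalIntegral.integral_eq_sub_of_hasDerivAt (fun t _ => (hA t).inner ℝ (hB t))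
    (by apply Continuous.intervalIntegrable; fun_prop)]
  simp

/-- Integration by parts for primitives of functions in `L²((0, T); H)`. -/
theorem inner_volterra_add_inner_volterra (hT : 0 ≤ T) (y z : L2Time H T) :
    inner ℝ (volterra y) z + inner ℝ y (volterra z)
      = inner ℝ (totalIntegral hT y) (totalIntegral hT z) := by
  -- Both sides are continuous in `(y, z)`, so bounded continuous functions suffice.
  have hd := BoundedContinuousFunction.toLp_denseRange (p := 2) H
    ((volume : Measure ℝ).restrict (Ioo 0 T)) ℝ (by norm_num)
  refine hd.induction_on₂ (p := fun y z => inner ℝ (volterra y) z + inner ℝ y (volterra z)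
    = inner ℝ (totalIntegral hT y) (totalIntegral hT z)) ?_ ?_ y z
  · exact isClosed_eq (by fun_prop) (by fun_prop)
  · intro a b
    have h1 : ∀ c : BoundedContinuousFunction ℝ H, ∀ t ∈ Icc 0 T,
        ∫ s in 0..t, (c.toLp 2 ((volume : Measure ℝ).restrict (Ioo 0 T)) ℝ) s
          = ∫ s in 0..t, c s := fun c t ht => by
      simp only [intervalIntegral.integral_of_le ht.1, integral_Ioc_eq_integral_Ioo]
      exact integral_congr_ae (ae_restrict_of_ae_restrict_of_subset (Ioo_subset_Ioo_right ht.2)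
        (BoundedContinuousFunction.coeFn_toLp ..))
    rw [totalIntegral_apply, totalIntegral_apply, h1 a T ⟨hT, le_rfl⟩, h1 b T ⟨hT, le_rfl⟩,
      ← integral_inner_primitive_add a.continuous b.continuous, L2.inner_def, L2.inner_def,
      ← integral_add (L2.integrable_inner _ _) (L2.integrable_inner _ _),
      intervalIntegral.integral_of_le hT, integral_Ioc_eq_integral_Ioo]
    refine integral_congr_ae ?_
    filter_upwards [ae_restrict_mem measurableSet_Ioo, coeFn_volterra (a.toLp 2
      ((volume : Measure ℝ).restrict (Ioo 0 T)) ℝ), coeFn_volterra (b.toLp 2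
      ((volume : Measure ℝ).restrict (Ioo 0 T)) ℝ), BoundedContinuousFunction.coeFn_toLp 2
      ((volume : Measure ℝ).restrict (Ioo 0 T)) ℝ a, BoundedContinuousFunction.coeFn_toLp 2
      ((volume : Measure ℝ).restrict (Ioo 0 T)) ℝ b] with t ht h2 h3 h4 h5
    rw [h2, h3, h4, h5, h1 a t (Ioo_subset_Icc_self ht), h1 b t (Ioo_subset_Icc_self ht)]

theorem inner_volterra_self_nonneg (hT : 0 ≤ T) (y : L2Time H T) :
    0 ≤ inner ℝ (volterra y) y := by
  have h := inner_volterra_add_inner_volterra hT y y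
  rw [real_inner_comm (volterra y) y] at h
  linarith [real_inner_self_nonneg (x := totalIntegral hT y)]

theorem compLpL_primitive (A : H →L[ℝ] H) (y : L2Time H T) {t : ℝ} (ht : t ∈ Icc 0 T) :
    ∫ s in 0..t, A.compLpL 2 ((volume : Measure ℝ).restrict (Ioo 0 T)) y s
      = A (∫ s in 0..t, y s) := by
  rw [← A.intervalIntegral_comp_comm (y.intervalIntegrable ht)]
  simp only [intervalIntegral.integral_of_le ht.1, integral_Ioc_eq_integral_Ioo]
  exact integral_congr_ae (ae_restrict_of_ae_restrict_of_subset (Ioo_subset_Ioo_right ht.2)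
    (A.coeFn_compLpL y))

theorem compLpL_volterra (A : H →L[ℝ] H) (y : L2Time H T) :
    A.compLpL 2 ((volume : Measure ℝ).restrict (Ioo 0 T)) (volterra y)
      = volterra (A.compLpL 2 ((volume : Measure ℝ).restrict (Ioo 0 T)) y) := by
  refine Lp.ext ?_
  filter_upwards [ae_restrict_mem measurableSet_Ioo, A.coeFn_compLpL (volterra y),
    coeFn_volterra y, coeFn_volterra (A.compLpL 2 ((volume : Measure ℝ).restrict (Ioo 0 T)) y)]
    with t ht h1 h2 h3
  rw [h1, h2, h3, compLpL_primitive A y (Ioo_subset_Icc_self ht)]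

/-- Integration by parts with `z = A y`: since `A` is symmetric and commutes with integration, the
two terms on the left coincide and the right side is `⟪∫ y, A ∫ y⟫`. -/
theorem inner_compLpL_volterra_nonneg (hT : 0 ≤ T) {A : H →L[ℝ] H}
    (hA : ∀ a b, inner ℝ (A a) b = inner ℝ a (A b)) (hA0 : ∀ a, 0 ≤ inner ℝ (A a) a)
    (y : L2Time H T) :
    0 ≤ inner ℝ (A.compLpL 2 ((volume : Measure ℝ).restrict (Ioo 0 T)) y) (volterra y) := by
  have h := inner_volterra_add_inner_volterra hT y
    (A.compLpL 2 ((volume : Measure ℝ).restrict (Ioo 0 T)) y)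
  rw [← compLpL_volterra, ← inner_compLpL_comm hA y (volterra y), totalIntegral_apply, totalIntegral_apply,
    compLpL_primitive A y ⟨hT, le_rfl⟩, real_inner_comm _ (volterra y),
    real_inner_comm (A _)] at h
  linarith [hA0 (∫ s in 0..T, y s)]

end Volterra

/-! ### Test functions -/

section TestFunctions

variable {V : Type*} [NormedAddCommGroup V] [NormedSpace ℝ V] {U : Set V} {φ ψ : V → ℝ}

theorem IsTestFunction.eq_zero_of_notMem (hφ : IsTestFunction U φ) {x : V} (hx : x ∉ U) :
    φ x = 0 :=
  image_eq_zero_of_notMem_tsupport fun h => hx (hφ.2.2 h)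

theorem IsTestFunction.add (hφ : IsTestFunction U φ) (hψ : IsTestFunction U ψ) :
    IsTestFunction U (φ + ψ) :=
  ⟨hφ.1.add hψ.1, hφ.2.1.add hψ.2.1,
    (tsupport_add φ ψ).trans (union_subset hφ.2.2 hψ.2.2)⟩

theorem IsTestFunction.mul_left {g : V → ℝ} (hg : ContDiff ℝ ∞ g) (hφ : IsTestFunction U φ) :
    IsTestFunction U fun x => g x * φ x :=
  ⟨hg.mul hφ.1, hφ.2.1.mul_left, (tsupport_mul_subset_right (f := g) (g := φ)).trans hφ.2.2⟩

theorem IsTestFunction.zero : IsTestFunction U (0 : V → ℝ) :=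
  ⟨contDiff_const, HasCompactSupport.zero, by simp⟩

theorem IsTestFunction.fderiv_apply (hφ : IsTestFunction U φ) (v : V) :
    IsTestFunction U fun x => fderiv ℝ φ x v := by
  refine ⟨(hφ.1.fderiv_right (m := ∞) (by simp)).clm_apply contDiff_const,
    hφ.2.1.fderiv_apply ℝ v, ?_⟩
  refine (closure_mono fun x hx => ?_).trans ((tsupport_fderiv_subset ℝ).trans hφ.2.2)
  simp only [Function.mem_support] at hx ⊢
  exact fun h => hx (by simp [h])

theorem IsTestFunction.differentiable (hφ : IsTestFunction U φ) : Differentiable ℝ φ :=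
  hφ.1.differentiable (by simp)

theorem IsTestFunction.continuous (hφ : IsTestFunction U φ) : Continuous φ :=
  hφ.1.continuous

/-- The space `C_c^∞(U)`. -/
def testFunctions (U : Set V) : Submodule ℝ (V → ℝ) where
  carrier := {φ | IsTestFunction U φ}
  add_mem' := IsTestFunction.add
  zero_mem' := IsTestFunction.zero
  smul_mem' c _ hφ := hφ.mul_left (g := fun _ => c) contDiff_const

variable [MeasurableSpace V] [BorelSpace V] {μ : Measure V}

section

variable [IsFiniteMeasureOnCompacts μ]

theorem IsTestFunction.integrable (hφ : IsTestFunction U φ) : Integrable φ μ :=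
  hφ.continuous.integrable_of_hasCompactSupport hφ.2.1

theorem IsTestFunction.memLp (hφ : IsTestFunction U φ) {p : ENNReal} :
    MemLp φ p (μ.restrict U) :=
  (hφ.continuous.memLp_of_hasCompactSupport hφ.2.1).restrict U

end

/-- The integrands vanish off `U`, so the integration by parts takes place on all of `V` and has no
boundary terms. -/
theorem IsTestFunction.integral_mul_fderiv_apply [FiniteDimensional ℝ V] [μ.IsAddHaarMeasure]
    (hφ : IsTestFunction U φ) (hψ : IsTestFunction U ψ) (v : V) :
    ∫ x in U, φ x * fderiv ℝ ψ x v ∂μ = - ∫ x in U, fderiv ℝ φ x v * ψ x ∂μ := by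
  rw [setIntegral_eq_integral_of_forall_compl_eq_zero fun x hx => by
      simp [hφ.eq_zero_of_notMem hx],
    setIntegral_eq_integral_of_forall_compl_eq_zero fun x hx => by
      simp [hψ.eq_zero_of_notMem hx]]
  refine integral_mul_fderiv_eq_neg_fderiv_mul_of_integrable ?_ ?_ ?_ ?_ ?_
  · exact (hψ.mul_left (hφ.fderiv_apply v).1).integrable
  · exact ((hψ.fderiv_apply v).mul_left hφ.1).integrable
  · exact (hψ.mul_left hφ.1).integrable
  · exact fun x _ => hφ.differentiable x
  · exact fun x _ => hψ.differentiable x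

/-- A square integrable function on an open set that is orthogonal to all test functions vanishes. -/
theorem ae_eq_zero_of_forall_integral_mul_testFunction [IsFiniteMeasureOnCompacts μ] [FiniteDimensional ℝ V] (hU : IsOpen U)
    {f : V → ℝ} (hf : MemLp f 2 (μ.restrict U))
    (h : ∀ φ, IsTestFunction U φ → ∫ x in U, f x * φ x ∂μ = 0) : f =ᵐ[μ.restrict U] 0 := by
  have h1 : LocallyIntegrableOn f U μ := by
    rw [locallyIntegrableOn_iff hU.isLocallyClosed]
    intro K hK hKc
    have : MemLp f 2 (μ.restrict K) := hf.mono_measure (Measure.restrict_mono hK le_rfl)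
    have : IsFiniteMeasure (μ.restrict K) := ⟨by simpa using hKc.measure_lt_top⟩
    exact MemLp.integrable (by norm_num) ‹MemLp f 2 (μ.restrict K)›
  have h2 := hU.ae_eq_zero_of_integral_contDiff_smul_eq_zero h1 fun g hg hgc hgU => by
    have hgt : IsTestFunction U g := ⟨hg, hgc, hgU⟩
    rw [← setIntegral_eq_integral_of_forall_compl_eq_zero (s := U) fun x hx => by
      simp [hgt.eq_zero_of_notMem hx]]
    simpa [mul_comm] using h g hgt
  exact (ae_restrict_iff' hU.measurableSet).2 h2

end TestFunctions

/-! ### The inverse of the Dirichlet Laplacian -/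

section Dirichlet

variable {d : ℕ} {Ω : Set (Space d)}

/-- The space `L²(Ω)`. -/
abbrev L2Space (Ω : Set (Space d)) : Type := Lp ℝ 2 ((volume : Measure (Space d)).restrict Ω)

theorem gradient_apply (φ : Space d → ℝ) (x : Space d) (i : Fin d) :
    gradient φ x i = fderiv ℝ φ x (EuclideanSpace.single i 1) := by
  rw [← inner_gradient_left, EuclideanSpace.inner_single_right]
  simp

theorem laplacian_apply (φ : Space d → ℝ) (hφ : ContDiff ℝ 2 φ) (x : Space d) :
    (Δ φ) x = ∑ i, fderiv ℝ (fun y => fderiv ℝ φ y (EuclideanSpace.single i 1)) x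
      (EuclideanSpace.single i 1) := by
  rw [InnerProductSpace.laplacian_eq_iteratedFDeriv_orthonormalBasis φ
    (EuclideanSpace.basisFun (Fin d) ℝ)]
  refine Finset.sum_congr rfl fun i _ => ?_
  rw [iteratedFDeriv_two_apply, fderiv_clm_apply
    ((hφ.fderiv_right (m := 1) (by norm_num)).differentiable (by norm_num) x) (by fun_prop)]
  simp

theorem inner_gradient_gradient (φ ψ : Space d → ℝ) (x : Space d) :
    inner ℝ (gradient φ x) (gradient ψ x) = ∑ i, fderiv ℝ φ x (EuclideanSpace.single i 1) *
      fderiv ℝ ψ x (EuclideanSpace.single i 1) := by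
  rw [PiLp.inner_apply]
  refine Finset.sum_congr rfl fun i _ => ?_
  rw [← gradient_apply, ← gradient_apply]
  simp [mul_comm]

theorem gradient_add_apply {φ ψ : Space d → ℝ} (hφ : Differentiable ℝ φ)
    (hψ : Differentiable ℝ ψ) : gradient (φ + ψ) = gradient φ + gradient ψ := by
  ext x i
  simp [gradient_apply, fderiv_add (hφ x) (hψ x)]

theorem gradient_const_smul (c : ℝ) {φ : Space d → ℝ} (hφ : Differentiable ℝ φ) :
    gradient (c • φ) = c • gradient φ := by
  ext x i
  simp [gradient_apply, fderiv_const_smul (hφ x)]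

theorem IsTestFunction.memLp_gradient {φ : Space d → ℝ} (hφ : IsTestFunction Ω φ) :
    MemLp (gradient φ) 2 (volume.restrict Ω) := by
  have hc : Continuous (gradient φ) :=
    (InnerProductSpace.toDual ℝ (Space d)).symm.continuous.comp
      (hφ.1.continuous_fderiv (by simp))
  refine (hc.memLp_of_hasCompactSupport ?_).restrict Ω
  exact (hφ.2.1.fderiv ℝ).comp_left (g := (InnerProductSpace.toDual ℝ (Space d)).symm) (map_zero _)

theorem IsTestFunction.laplacian {φ : Space d → ℝ} (hφ : IsTestFunction Ω φ) :
    IsTestFunction Ω (Δ φ) := by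
  have h : Δ φ = ∑ i, fun x => fderiv ℝ (fun y => fderiv ℝ φ y (EuclideanSpace.single i 1)) x
      (EuclideanSpace.single i 1) := by
    ext x
    rw [laplacian_apply φ (contDiff_infty.1 hφ.1 2), Finset.sum_apply]
  rw [h]
  exact Submodule.sum_mem (testFunctions Ω) fun i _ => (hφ.fderiv_apply _).fderiv_apply _

/-- The class of a test function in `L²(Ω)`. -/
def testToLp (Ω : Set (Space d)) : testFunctions Ω →ₗ[ℝ] L2Space Ω where
  toFun φ := φ.2.memLp.toLp
  map_add' φ ψ := MemLp.toLp_add φ.2.memLp ψ.2.memLp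
  map_smul' c φ := MemLp.toLp_const_smul c φ.2.memLp

/-- The class of the gradient of a test function in `L²(Ω; ℝᵈ)`. -/
def testGradient (Ω : Set (Space d)) :
    testFunctions Ω →ₗ[ℝ] Lp (Space d) 2 ((volume : Measure (Space d)).restrict Ω) where
  toFun φ := φ.2.memLp_gradient.toLp
  map_add' φ ψ := by
    rw [← MemLp.toLp_add φ.2.memLp_gradient ψ.2.memLp_gradient]
    congr 1
    exact gradient_add_apply φ.2.differentiable ψ.2.differentiable
  map_smul' c φ := by
    rw [RingHom.id_apply, ← MemLp.toLp_const_smul c φ.2.memLp_gradient]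
    congr 1
    exact gradient_const_smul c φ.2.differentiable

/-- The gradients of functions in `H₀¹(Ω)`: the closure of the gradients of test functions. -/
abbrev gradientSpace (Ω : Set (Space d)) :
    Submodule ℝ (Lp (Space d) 2 ((volume : Measure (Space d)).restrict Ω)) :=
  (LinearMap.range (testGradient Ω)).topologicalClosure

/-- The gradient of a test function, as an element of `gradientSpace`. -/
def testGradient' (Ω : Set (Space d)) : testFunctions Ω →ₗ[ℝ] gradientSpace Ω :=
  (testGradient Ω).codRestrict _ fun φ => Submodule.le_topologicalClosure _ ⟨φ, rfl⟩

theorem denseRange_testGradient' : DenseRange (testGradient' Ω) := by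
  intro G
  rw [closure_subtype]
  have : (Subtype.val '' range (testGradient' Ω)) = LinearMap.range (testGradient Ω) := by
    rw [← range_comp]; rfl
  rw [this]
  exact G.2

theorem norm_testToLp_sq (φ : testFunctions Ω) :
    ‖testToLp Ω φ‖ ^ 2 = ∫ x in Ω, φ.1 x * φ.1 x := by
  rw [← real_inner_self_eq_norm_sq, L2.inner_def]
  refine integral_congr_ae ?_
  filter_upwards [φ.2.memLp.coeFn_toLp (p := 2)] with x hx
  simp only [testToLp, LinearMap.coe_mk, AddHom.coe_mk]
  rw [hx]; rfl

theorem inner_testGradient (φ ψ : testFunctions Ω) :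
    inner ℝ (testGradient Ω φ) (testGradient Ω ψ)
      = ∫ x in Ω, inner ℝ (gradient φ.1 x) (gradient ψ.1 x) := by
  rw [L2.inner_def]
  refine integral_congr_ae ?_
  filter_upwards [φ.2.memLp_gradient.coeFn_toLp, ψ.2.memLp_gradient.coeFn_toLp] with x hx hx'
  simp only [testGradient, LinearMap.coe_mk, AddHom.coe_mk]
  rw [hx, hx']

/-- The **Poincaré inequality** for test functions on a bounded set. -/
theorem norm_testToLp_le (hd : 0 < d) {R : ℝ} (hR : ∀ x ∈ Ω, ‖x‖ ≤ R) (hR0 : 0 ≤ R)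
    (φ : testFunctions Ω) :
    ‖testToLp Ω φ‖ ≤ 2 * R * ‖testGradient Ω φ‖ := by
  let i : Fin d := ⟨0, hd⟩
  have hφ : IsTestFunction Ω φ.1 := φ.2
  have hc : ContDiff ℝ ∞ fun x : Space d => x i := by fun_prop
  -- Integrating `xᵢ φ ∂ᵢφ` by parts yields `∫ φ² = -2 ∫ xᵢ φ ∂ᵢφ`. A coordinate `i` exists because
  -- `d > 0`.
  have h1 := (hφ.mul_left hc).integral_mul_fderiv_apply (μ := volume) hφ (EuclideanSpace.single i 1)
  have h2 : ∀ x, fderiv ℝ (fun x => x i * φ.1 x) x (EuclideanSpace.single i 1)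
      = φ.1 x + x i * fderiv ℝ φ.1 x (EuclideanSpace.single i 1) := fun x => by
    rw [fderiv_fun_mul (hc.differentiable (by simp) x) (hφ.differentiable x)]
    have : fderiv ℝ (fun x : Space d => x i) x = EuclideanSpace.proj i :=
      (EuclideanSpace.proj (𝕜 := ℝ) i).fderiv
    simp [this]
    ring
  simp_rw [h2] at h1
  have i1 : IntegrableOn (fun x => φ.1 x * φ.1 x) Ω := (hφ.mul_left hφ.1).integrable.integrableOn
  have i2 : IntegrableOn (fun x => x i * φ.1 x * fderiv ℝ φ.1 x (EuclideanSpace.single i 1)) Ω :=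
    ((hφ.fderiv_apply _).mul_left (hφ.mul_left hc).1).integrable.integrableOn
  have i3 : IntegrableOn (fun x => inner ℝ (gradient φ.1 x) (gradient φ.1 x)) Ω := by
    refine Integrable.congr (L2.integrable_inner (𝕜 := ℝ) (testGradient Ω φ) (testGradient Ω φ)) ?_
    filter_upwards [φ.2.memLp_gradient.coeFn_toLp] with x hx
    simp only [testGradient, LinearMap.coe_mk, AddHom.coe_mk]
    rw [hx]
  have h3 : ∫ x in Ω, (φ.1 x + x i * fderiv ℝ φ.1 x (EuclideanSpace.single i 1)) * φ.1 x
      = (∫ x in Ω, φ.1 x * φ.1 x)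
        + ∫ x in Ω, x i * φ.1 x * fderiv ℝ φ.1 x (EuclideanSpace.single i 1) := by
    rw [← integral_add i1 i2]
    congr 1; ext x; ring
  rw [h3] at h1
  -- Young's inequality `-2ab ≤ a²/2 + 2b²` with `a = φ`, `b = xᵢ ∂ᵢφ`, and `|xᵢ| ≤ R`. Absorbing
  -- the first term leaves `‖φ‖² ≤ 4R² ‖∇φ‖²`.
  have h4 : ∫ x in Ω, φ.1 x * φ.1 x ≤
      ∫ x in Ω, (1 / 2 * (φ.1 x * φ.1 x)
        + 2 * R ^ 2 * inner ℝ (gradient φ.1 x) (gradient φ.1 x)) := by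
    have h5 : ∫ x in Ω, φ.1 x * φ.1 x
        = ∫ x in Ω, -2 * (x i * φ.1 x * fderiv ℝ φ.1 x (EuclideanSpace.single i 1)) := by
      rw [integral_const_mul]; linarith
    rw [h5]
    refine integral_mono_ae (i2.const_mul _) ((i1.const_mul _).add (i3.const_mul _)) ?_
    refine ae_of_all _ fun x => ?_
    have h6 : (fderiv ℝ φ.1 x (EuclideanSpace.single i 1)) ^ 2
        ≤ inner ℝ (gradient φ.1 x) (gradient φ.1 x) := by
      rw [inner_gradient_gradient, sq]
      exact Finset.single_le_sum (f := fun j => fderiv ℝ φ.1 x (EuclideanSpace.single j 1) *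
        fderiv ℝ φ.1 x (EuclideanSpace.single j 1)) (fun j _ => mul_self_nonneg _)
        (Finset.mem_univ i)
    have h7 : 0 ≤ inner ℝ (gradient φ.1 x) (gradient φ.1 x) := real_inner_self_nonneg
    by_cases hx : x ∈ Ω
    · have h8 : (x i) ^ 2 ≤ R ^ 2 := by
        rw [sq_le_sq, abs_of_nonneg hR0]
        exact (PiLp.norm_apply_le x i).trans (hR x hx)
      have h9 := mul_le_mul h8 h6 (sq_nonneg _) (sq_nonneg _)
      nlinarith [sq_nonneg (φ.1 x + 2 * (x i * fderiv ℝ φ.1 x (EuclideanSpace.single i 1)))]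
    · simp only [hφ.eq_zero_of_notMem hx]
      nlinarith [mul_nonneg (sq_nonneg R) h7]
  rw [integral_add (i1.const_mul _) (i3.const_mul _), integral_const_mul, integral_const_mul,
    ← inner_testGradient, real_inner_self_eq_norm_sq, ← norm_testToLp_sq] at h4
  rw [← sq_le_sq₀ (norm_nonneg _) (by positivity)]
  nlinarith

end Dirichlet

/-! ### The solution operator of the Dirichlet problem -/

section Dirichlet

variable {d : ℕ} {Ω : Set (Space d)}

/-- The potential: the bounded extension of `∇ φ ↦ φ` to `gradientSpace Ω`. -/
def potential (Ω : Set (Space d)) : gradientSpace Ω →L[ℝ] L2Space Ω :=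
  (testToLp Ω).extendOfNorm (testGradient' Ω)

/-- The Poincaré inequality is the norm bound under which the extension takes its prescribed values.
-/
theorem potential_testGradient' (hd : 0 < d) (hΩb : Bornology.IsBounded Ω)
    (φ : testFunctions Ω) : potential Ω (testGradient' Ω φ) = testToLp Ω φ := by
  refine LinearMap.extendOfNorm_eq denseRange_testGradient' ?_ φ
  obtain ⟨R, hR0, hR⟩ := hΩb.exists_pos_norm_le
  exact ⟨2 * R, norm_testToLp_le hd hR hR0.le⟩

/-- The adjoint of `potential Ω`. -/
def potentialAdjoint (Ω : Set (Space d)) : L2Space Ω →L[ℝ] gradientSpace Ω :=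
  ContinuousLinearMap.adjoint (potential Ω)

/-- For `G = ∇φ` this is the weak form of `-Δ w = a`: the adjoint sends `a` to the gradient of the
solution, and `potential` recovers the solution from it. -/
theorem inner_potentialAdjoint (a : L2Space Ω) (G : gradientSpace Ω) :
    inner ℝ (potentialAdjoint Ω a) G = inner ℝ a (potential Ω G) :=
  ContinuousLinearMap.adjoint_inner_left _ _ _

/-- The inverse of `-Δ` with homogeneous Dirichlet boundary conditions, on `L²(Ω)`. -/
def dirichletInverse (Ω : Set (Space d)) : L2Space Ω →L[ℝ] L2Space Ω :=
  (potential Ω).comp (potentialAdjoint Ω)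

theorem dirichletInverse_apply (a : L2Space Ω) :
    dirichletInverse Ω a = potential Ω (potentialAdjoint Ω a) := rfl

theorem inner_dirichletInverse (a b : L2Space Ω) :
    inner ℝ (dirichletInverse Ω a) b
      = inner ℝ (potentialAdjoint Ω a) (potentialAdjoint Ω b) := by
  rw [dirichletInverse_apply, real_inner_comm, ← inner_potentialAdjoint, real_inner_comm]

theorem inner_dirichletInverse_comm (a b : L2Space Ω) :
    inner ℝ (dirichletInverse Ω a) b = inner ℝ a (dirichletInverse Ω b) := by
  rw [inner_dirichletInverse, real_inner_comm (dirichletInverse Ω b) a, inner_dirichletInverse,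
    real_inner_comm]

theorem inner_dirichletInverse_self_nonneg (a : L2Space Ω) :
    0 ≤ inner ℝ (dirichletInverse Ω a) a := by
  rw [inner_dirichletInverse]; exact real_inner_self_nonneg

theorem inner_testToLp (a : L2Space Ω) (φ : testFunctions Ω) :
    inner ℝ a (testToLp Ω φ) = ∫ x in Ω, a x * φ.1 x := by
  rw [L2.inner_def]
  refine integral_congr_ae ?_
  filter_upwards [φ.2.memLp.coeFn_toLp (p := 2)] with x hx
  simp only [testToLp, LinearMap.coe_mk, AddHom.coe_mk]
  rw [hx]
  simp [mul_comm]

theorem eq_zero_of_inner_testToLp (hΩ : IsOpen Ω) {a : L2Space Ω}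
    (h : ∀ φ, inner ℝ a (testToLp Ω φ) = 0) : a = 0 := by
  rw [Lp.eq_zero_iff_ae_eq_zero]
  refine ae_eq_zero_of_forall_integral_mul_testFunction hΩ (Lp.memLp a) fun φ hφ => ?_
  rw [← inner_testToLp a ⟨φ, hφ⟩, h]

/-- The quadratic form is the squared norm of `potentialAdjoint Ω a`. If it vanishes, `a` is
orthogonal to every test function. -/
theorem eq_zero_of_inner_dirichletInverse_self (hΩ : IsOpen Ω) (hd : 0 < d)
    (hΩb : Bornology.IsBounded Ω) {a : L2Space Ω}
    (h : inner ℝ (dirichletInverse Ω a) a = 0) : a = 0 := by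
  rw [inner_dirichletInverse, inner_self_eq_zero] at h
  refine eq_zero_of_inner_testToLp hΩ fun φ => ?_
  rw [← potential_testGradient' hd hΩb, ← inner_potentialAdjoint, h,
    inner_zero_left]

theorem inner_testToLp_laplacian (φ : testFunctions Ω) {ψ : Space d → ℝ}
    (hψ : IsTestFunction Ω ψ) :
    inner ℝ (testToLp Ω φ) (testToLp Ω ⟨Δ ψ, hψ.laplacian⟩)
      = - inner ℝ (testGradient Ω φ) (testGradient Ω ⟨ψ, hψ⟩) := by
  have hφ : IsTestFunction Ω φ.1 := φ.2
  rw [inner_testToLp, inner_testGradient]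
  have h1 : ∫ x in Ω, testToLp Ω φ x * (Δ ψ) x = ∫ x in Ω, φ.1 x * (Δ ψ) x := by
    refine integral_congr_ae ?_
    filter_upwards [φ.2.memLp.coeFn_toLp (p := 2)] with x hx
    simp only [testToLp, LinearMap.coe_mk, AddHom.coe_mk]
    rw [hx]
  rw [h1]
  simp_rw [laplacian_apply ψ (contDiff_infty.1 hψ.1 2),
    inner_gradient_gradient, Finset.mul_sum]
  rw [integral_finsetSum, integral_finsetSum, ← Finset.sum_neg_distrib]
  · exact Finset.sum_congr rfl fun i _ =>
      hφ.integral_mul_fderiv_apply (hψ.fderiv_apply _) _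
  · exact fun i _ => ((hψ.fderiv_apply _).mul_left (hφ.fderiv_apply _).1).integrable.integrableOn
  · exact fun i _ => (((hψ.fderiv_apply _).fderiv_apply _).mul_left hφ.1).integrable.integrableOn

theorem inner_potential_laplacian (hd : 0 < d) (hΩb : Bornology.IsBounded Ω)
    (G : gradientSpace Ω) {ψ : Space d → ℝ} (hψ : IsTestFunction Ω ψ) :
    inner ℝ (potential Ω G) (testToLp Ω ⟨Δ ψ, hψ.laplacian⟩)
      = - inner ℝ G (testGradient' Ω ⟨ψ, hψ⟩) := by
  refine denseRange_testGradient'.induction_on (p := fun G =>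
    inner ℝ (potential Ω G) (testToLp Ω ⟨Δ ψ, hψ.laplacian⟩)
      = - inner ℝ G (testGradient' Ω ⟨ψ, hψ⟩)) G ?_ fun φ => ?_
  · exact isClosed_eq (by fun_prop) (by fun_prop)
  · rw [potential_testGradient' hd hΩb]
    exact inner_testToLp_laplacian φ hψ

theorem isWeakGradient_potential (hd : 0 < d) (hΩb : Bornology.IsBounded Ω)
    (G : gradientSpace Ω) : IsWeakGradient Ω (potential Ω G) (G : Lp (Space d) 2 (volume.restrict Ω)) := by
  intro ψ hψ
  have hm : ∀ c : Space d, MemLp (fun x => ψ x • c) 2 (volume.restrict Ω) := fun c =>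
    ((hψ.continuous.smul continuous_const).memLp_of_hasCompactSupport hψ.2.1.smul_right).restrict Ω
  -- One direction `c` at a time the identity is scalar and continuous in `G`, so it extends by
  -- density from gradients of test functions.
  have key : ∀ c : Space d, inner ℝ (potential Ω G) (testToLp Ω ⟨_, hψ.fderiv_apply c⟩)
      = - inner ℝ (G : Lp (Space d) 2 (volume.restrict Ω)) (hm c).toLp := by
    intro c
    refine denseRange_testGradient'.induction_on (p := fun G : gradientSpace Ω =>
      inner ℝ (potential Ω G) (testToLp Ω ⟨_, hψ.fderiv_apply c⟩)
        = - inner ℝ (G : Lp (Space d) 2 (volume.restrict Ω)) (hm c).toLp) G ?_ fun φ => ?_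
    · exact isClosed_eq (by fun_prop) (by fun_prop)
    · have hφ : IsTestFunction Ω φ.1 := φ.2
      rw [potential_testGradient' hd hΩb, inner_testToLp, L2.inner_def]
      have h1 : ∫ x in Ω, testToLp Ω φ x * fderiv ℝ ψ x c = ∫ x in Ω, φ.1 x * fderiv ℝ ψ x c := by
        refine integral_congr_ae ?_
        filter_upwards [φ.2.memLp.coeFn_toLp (p := 2)] with x hx
        simp only [testToLp, LinearMap.coe_mk, AddHom.coe_mk]
        rw [hx]
      rw [h1, hφ.integral_mul_fderiv_apply hψ]
      congr 1
      refine integral_congr_ae ?_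
      filter_upwards [φ.2.memLp_gradient.coeFn_toLp, (hm c).coeFn_toLp] with x hx hx'
      change _ = inner ℝ (testGradient Ω φ x) _
      simp only [testGradient, LinearMap.coe_mk, AddHom.coe_mk]
      rw [hx, hx', inner_smul_right, inner_gradient_left, mul_comm]
  have i1 : Integrable (fun x => potential Ω G x • gradient ψ x) (volume.restrict Ω) :=
    memLp_one_iff_integrable.1 (MemLp.smul (p := 2) (q := 2) (φ := potential Ω G)
      hψ.memLp_gradient (Lp.memLp _))
  have i2 : Integrable (fun x => ψ x • (G : Lp (Space d) 2 (volume.restrict Ω)) x) (volume.restrict Ω) :=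
    memLp_one_iff_integrable.1 (MemLp.smul (p := 2) (q := 2) (Lp.memLp _) hψ.memLp)
  refine ext_inner_left ℝ fun c => ?_
  rw [inner_neg_right, ← integral_inner i1, ← integral_inner i2]
  have h := key c
  rw [inner_testToLp, L2.inner_def] at h
  refine Eq.trans (integral_congr_ae (ae_of_all _ fun x => ?_)) (h.trans (congrArg Neg.neg
    (integral_congr_ae ?_)))
  · simp only [inner_smul_right]
    rw [real_inner_comm, inner_gradient_left]
  · filter_upwards [(hm c).coeFn_toLp] with x hx
    rw [hx, inner_smul_right, inner_smul_right, real_inner_comm]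

theorem memH01_potential (hd : 0 < d) (hΩb : Bornology.IsBounded Ω) (G : gradientSpace Ω) :
    MemH01 Ω (potential Ω G) := by
  refine ⟨Lp.memLp _, (G : Lp (Space d) 2 (volume.restrict Ω)), Lp.memLp _, isWeakGradient_potential hd hΩb G, ?_⟩
  obtain ⟨w, hw, hlim⟩ := mem_closure_iff_seq_limit.1 (denseRange_testGradient' G)
  choose φ hφ using hw
  have h1 : Tendsto (fun n => testGradient' Ω (φ n)) atTop (𝓝 G) := by simpa only [hφ] using hlim
  have h2 : Tendsto (fun n => testToLp Ω (φ n)) atTop (𝓝 (potential Ω G)) := by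
    refine (((potential Ω).continuous.tendsto _).comp h1).congr fun n => ?_
    exact potential_testGradient' hd hΩb (φ n)
  have h3 : Tendsto (fun n => testGradient Ω (φ n)) atTop (𝓝 (G : Lp (Space d) 2 (volume.restrict Ω))) :=
    (continuous_subtype_val.tendsto _).comp h1
  refine ⟨fun n => (φ n).1, fun n => (φ n).2, ?_, ?_⟩
  · rw [Lp.tendsto_Lp_iff_tendsto_eLpNorm'] at h2
    refine h2.congr fun n => eLpNorm_congr_ae ?_
    exact ((φ n).2.memLp.coeFn_toLp).sub (ae_eq_refl _)
  · rw [Lp.tendsto_Lp_iff_tendsto_eLpNorm'] at h3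
    refine h3.congr fun n => eLpNorm_congr_ae ?_
    exact ((φ n).2.memLp_gradient.coeFn_toLp).sub (ae_eq_refl _)

theorem IsWeakLaplacian.congr {w w' z z' : Space d → ℝ} (h : IsWeakLaplacian Ω w z)
    (hw : w =ᵐ[volume.restrict Ω] w') (hz : z =ᵐ[volume.restrict Ω] z') :
    IsWeakLaplacian Ω w' z' := by
  intro φ hφ
  refine Eq.trans (integral_congr_ae ?_) ((h φ hφ).trans (integral_congr_ae ?_))
  · filter_upwards [hw] with x hx using by rw [hx]
  · filter_upwards [hz] with x hx using by rw [hx]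

theorem MemH01.congr {w w' : Space d → ℝ} (h : MemH01 Ω w) (hw : w =ᵐ[volume.restrict Ω] w') :
    MemH01 Ω w' := by
  obtain ⟨h0, G, hG, hwG, φ, hφ, h1, h2⟩ := h
  refine ⟨(memLp_congr_ae hw).1 h0, G, hG, fun ψ hψ => ?_, φ, hφ, ?_, h2⟩
  · rw [← hwG ψ hψ]
    exact integral_congr_ae (hw.mono fun x hx => by simp only [hx])
  · exact h1.congr fun n => eLpNorm_congr_ae ((ae_eq_refl _).sub hw)

theorem isWeakLaplacian_dirichletInverse (hd : 0 < d) (hΩb : Bornology.IsBounded Ω)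
    (a : L2Space Ω) : IsWeakLaplacian Ω (dirichletInverse Ω a) (-a : L2Space Ω) := by
  intro φ hφ
  rw [← inner_testToLp _ ⟨Δ φ, hφ.laplacian⟩, ← inner_testToLp _ ⟨φ, hφ⟩, dirichletInverse_apply,
    inner_potential_laplacian hd hΩb,
    inner_potentialAdjoint, potential_testGradient' hd hΩb, inner_neg_left]

theorem memHDelta_dirichletInverse (hd : 0 < d) (hΩb : Bornology.IsBounded Ω)
    (a : L2Space Ω) : MemHDelta Ω (dirichletInverse Ω a) :=
  ⟨memH01_potential hd hΩb _, _, Lp.memLp _, isWeakLaplacian_dirichletInverse hd hΩb a⟩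

/-- The gradients of the approximating test functions converge to an element of `gradientSpace Ω`,
and `potential` is continuous. -/
theorem MemH01.exists_potential (hd : 0 < d) (hΩb : Bornology.IsBounded Ω) {w : L2Space Ω}
    (h : MemH01 Ω w) : ∃ G, potential Ω G = w := by
  obtain ⟨-, G, hG, -, φ, hφ, h1, h2⟩ := h
  have h3 : Tendsto (fun n => testToLp Ω ⟨φ n, hφ n⟩) atTop (𝓝 w) := by
    rw [Lp.tendsto_Lp_iff_tendsto_eLpNorm']
    refine h1.congr fun n => eLpNorm_congr_ae ?_
    exact ((hφ n).memLp.coeFn_toLp.symm).sub (ae_eq_refl _)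
  have h4 : Tendsto (fun n => testGradient Ω ⟨φ n, hφ n⟩) atTop (𝓝 hG.toLp) := by
    rw [Lp.tendsto_Lp_iff_tendsto_eLpNorm']
    refine h2.congr fun n => eLpNorm_congr_ae ?_
    exact ((hφ n).memLp_gradient.coeFn_toLp.symm).sub hG.coeFn_toLp.symm
  have hmem : hG.toLp ∈ gradientSpace Ω :=
    mem_closure_of_tendsto h4 (Eventually.of_forall fun n => ⟨_, rfl⟩)
  refine ⟨⟨hG.toLp, hmem⟩, tendsto_nhds_unique (((potential Ω).continuous.tendsto _).comp
    (tendsto_subtype_rng.2 h4 : Tendsto (fun n => testGradient' Ω ⟨φ n, hφ n⟩) atTop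
      (𝓝 ⟨hG.toLp, hmem⟩))) ?_⟩
  exact h3.congr fun n => (potential_testGradient' hd hΩb _).symm

/-- Write `w` as the potential of `G`. The weak equation says that `G` and `potentialAdjoint Ω (-z)`
have the same inner products with all test gradients, which are dense in `gradientSpace Ω`. -/
theorem eq_dirichletInverse_of_isWeakLaplacian (hd : 0 < d) (hΩb : Bornology.IsBounded Ω)
    {w z : L2Space Ω} (hw : MemH01 Ω w) (h : IsWeakLaplacian Ω w z) :
    w = dirichletInverse Ω (-z) := by
  obtain ⟨G, rfl⟩ := hw.exists_potential hd hΩb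
  rw [dirichletInverse_apply]
  congr 1
  refine denseRange_testGradient'.eq_of_inner_left (𝕜 := ℝ) fun φ => ?_
  have := h φ.1 φ.2
  rw [← inner_testToLp _ ⟨Δ φ.1, IsTestFunction.laplacian φ.2⟩,
    inner_potential_laplacian hd hΩb _ φ.2, ← inner_testToLp z φ] at this
  rw [inner_potentialAdjoint, potential_testGradient' hd hΩb, inner_neg_left, ← this, neg_neg]

end Dirichlet

/-! ### The weak time derivative -/

section DuBoisReymond

variable {T : ℝ}

theorem IsTestFunction.exists_primitive {θ : ℝ → ℝ} (hT : 0 < T) (hθ : IsTestFunction (Ioo 0 T) θ)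
    (h0 : ∫ t in 0..T, θ t = 0) : ∃ N, IsTestFunction (Ioo 0 T) N ∧ deriv N = θ := by
  have hc : Continuous θ := hθ.continuous
  have hd : ∀ t, HasDerivAt (fun t => ∫ s in 0..t, θ s) (θ t) t := fun t =>
    (hc.integral_hasStrictDerivAt 0 t).hasDerivAt
  have hderiv : deriv (fun t => ∫ s in 0..t, θ s) = θ := funext fun t => (hd t).deriv
  -- Adding `T / 2` keeps the compact set nonempty when `θ = 0`, so that it has a least and a
  -- greatest element.
  have hK : IsCompact (insert (T / 2) (tsupport θ)) := hθ.2.1.isCompact.insert _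
  have hKs : insert (T / 2) (tsupport θ) ⊆ Ioo 0 T :=
    insert_subset ⟨by linarith, by linarith⟩ hθ.2.2
  obtain ⟨α, hα, hαl⟩ := hK.exists_isLeast (insert_nonempty _ _)
  obtain ⟨β, hβ, hβl⟩ := hK.exists_isGreatest (insert_nonempty _ _)
  have hz : ∀ t, t ∉ Icc α β → θ t = 0 := fun t ht => image_eq_zero_of_notMem_tsupport fun h =>
    ht ⟨hαl (mem_insert_of_mem _ h), hβl (mem_insert_of_mem _ h)⟩
  have hsupp : ∀ t, t ∉ Icc α β → ∫ s in 0..t, θ s = 0 := by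
    intro t ht
    rcases not_and_or.1 ht with h | h
    · rw [not_le] at h
      refine (intervalIntegral.integral_congr fun s hs => ?_).trans intervalIntegral.integral_zero
      refine hz s fun hs' => ?_
      exact absurd (hs.2.trans_lt (max_lt (hKs hα).1 h)) (not_lt.2 hs'.1)
    · rw [not_le] at h
      rw [← intervalIntegral.integral_add_adjacent_intervals (hc.intervalIntegrable 0 T)
        (hc.intervalIntegrable T t), h0, zero_add]
      refine (intervalIntegral.integral_congr fun s hs => ?_).trans intervalIntegral.integral_zero
      refine hz s fun hs' => ?_
      exact absurd ((lt_min (hKs hβ).2 h).trans_le hs.1) (not_lt.2 hs'.2)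
  have hts : tsupport (fun t => ∫ s in 0..t, θ s) ⊆ Icc α β :=
    closure_minimal (fun t ht => by_contra fun h => ht (hsupp t h)) isClosed_Icc
  refine ⟨_, ⟨?_, ?_, ?_⟩, hderiv⟩
  · exact contDiff_infty_iff_deriv.2 ⟨fun t => (hd t).differentiableAt, by
      rw [hderiv]; exact hθ.1⟩
  · exact isCompact_Icc.of_isClosed_subset (isClosed_tsupport _) hts
  · exact hts.trans (Icc_subset_Ioo (hKs hα).1 (hKs hβ).2)

/-- The **du Bois-Reymond lemma** for continuous functions that vanish at the left end point. -/
theorem eqOn_zero_of_forall_integral_mul_deriv {a : ℝ → ℝ} (hT : 0 < T)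
    (ha : ContinuousOn a (Icc 0 T)) (ha0 : a 0 = 0)
    (h : ∀ η, IsTestFunction (Ioo 0 T) η → ∫ t in Ioo 0 T, a t * deriv η t = 0) :
    ∀ t ∈ Ioo 0 T, a t = 0 := by
  obtain ⟨C, hC⟩ := isCompact_Icc.exists_bound_of_continuousOn ha
  have hm : MemLp a 2 (volume.restrict (Ioo 0 T)) := by
    refine MemLp.of_bound ((ha.mono Ioo_subset_Icc_self).aestronglyMeasurable measurableSet_Ioo) C ?_
    filter_upwards [ae_restrict_mem measurableSet_Ioo] with t ht
    exact hC t (Ioo_subset_Icc_self ht)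
  have hint : ∀ η, IsTestFunction (Ioo 0 T) η → IntegrableOn (fun t => a t * η t) (Ioo 0 T) :=
    fun η hη => MemLp.integrable_mul (p := 2) (q := 2) hm hη.memLp
  let b : ContDiffBump (T / 2) := ⟨T / 8, T / 4, by linarith, by linarith⟩
  have hb : IsTestFunction (Ioo 0 T) (b.normed volume) := by
    refine ⟨b.contDiff_normed, b.hasCompactSupport_normed, ?_⟩
    rw [b.tsupport_normed_eq, Real.closedBall_eq_Icc]
    exact Icc_subset_Ioo (by simp only [b]; linarith) (by simp only [b]; linarith)
  have hint_eq : ∀ η, IsTestFunction (Ioo 0 T) η → ∫ t in 0..T, η t = ∫ t, η t := fun η hη => by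
    rw [intervalIntegral.integral_of_le hT.le, integral_Ioc_eq_integral_Ioo]
    exact setIntegral_eq_integral_of_forall_compl_eq_zero fun t ht => hη.eq_zero_of_notMem ht
  have hb1 : ∫ t in 0..T, b.normed volume t = 1 := by
    rw [hint_eq _ hb, b.integral_normed]
  set k := ∫ t in Ioo 0 T, a t * b.normed volume t with hk
  have hconst : (fun t => a t - k) =ᵐ[volume.restrict (Ioo 0 T)] 0 := by
    refine ae_eq_zero_of_forall_integral_mul_testFunction isOpen_Ioo (hm.sub (memLp_const k))
      fun η hη => ?_
    -- Subtracting `∫ η` times a bump of integral one leaves mean zero, so the result is the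
    -- derivative of a test function and `h` applies.
    have hθ : IsTestFunction (Ioo 0 T) (η + (-∫ t in 0..T, η t) • b.normed volume) :=
      hη.add (hb.mul_left contDiff_const)
    obtain ⟨N, hN, hNd⟩ := hθ.exists_primitive hT (by
      simp only [Pi.add_apply, Pi.smul_apply, smul_eq_mul]
      rw [intervalIntegral.integral_add (hη.continuous.intervalIntegrable _ _)
        ((hb.continuous.intervalIntegrable _ _).const_mul _), intervalIntegral.integral_const_mul,
        hb1]
      ring)
    have h1 := h N hN
    have h2 : ∀ t, a t * deriv N t = a t * η t
        - (∫ t in 0..T, η t) * (a t * b.normed volume t) := fun t => by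
      rw [hNd]; simp only [Pi.add_apply, Pi.smul_apply, smul_eq_mul]; ring
    simp_rw [h2] at h1
    rw [integral_sub (hint η hη) ((hint _ hb).const_mul _), integral_const_mul, ← hk,
      intervalIntegral.integral_of_le hT.le, integral_Ioc_eq_integral_Ioo] at h1
    simp_rw [sub_mul]
    rw [integral_sub (hint η hη) (hη.integrable.integrableOn.const_mul _), integral_const_mul]
    linarith
  have heq : EqOn (fun t => a t - k) (fun _ => 0) (Ioo 0 T) :=
    Measure.eqOn_open_of_ae_eq hconst isOpen_Ioo
      ((ha.mono Ioo_subset_Icc_self).sub continuousOn_const) continuousOn_const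
  have heq' : EqOn (fun t => a t - k) (fun _ => 0) (Icc 0 T) := by
    refine heq.of_subset_closure (ha.sub continuousOn_const) continuousOn_const
      Ioo_subset_Icc_self ?_
    rw [closure_Ioo hT.ne]
  -- So far `a` is the constant `k`, by continuity also at `t = 0`; the value there fixes `k`.
  have hk0 : k = 0 := by
    have := heq' ⟨le_rfl, hT.le⟩
    simp only [ha0] at this
    linarith
  intro t ht
  have := heq ht
  simp only [hk0] at this
  linarith

end DuBoisReymond

/-! ### Weak time derivatives as primitives in `L²((0, T); L²(Ω))` -/

section TimeDerivative

variable {d : ℕ} {Ω : Set (Space d)} {T : ℝ}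

theorem restrict_cylinder : (volume : Measure (Space d × ℝ)).restrict (cylinder Ω T)
    = ((volume : Measure (Space d)).restrict Ω).prod
      ((volume : Measure ℝ).restrict (Ioo 0 T)) := by
  rw [cylinder, Measure.volume_eq_prod, Measure.prod_restrict]

/-- The identification of `L²(Ω × (0, T))` with `L²((0, T); L²(Ω))`. -/
def timeEquiv (Ω : Set (Space d)) (T : ℝ) : L2Cyl Ω T ≃ₗᵢ[ℝ] L2Time (L2Space Ω) T :=
  sliceEquiv restrict_cylinder

theorem timeEquiv_spec (v : L2Cyl Ω T) :
    ∀ᵐ t ∂(volume.restrict (Ioo 0 T)), slice v t =ᵐ[volume.restrict Ω] timeEquiv Ω T v t :=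
  sliceEquiv_spec restrict_cylinder v

theorem timeEquiv_toLp_eq {F : Space d × ℝ → ℝ}
    (hF : MemLp F 2 ((volume : Measure (Space d × ℝ)).restrict (cylinder Ω T))) :
    ∀ᵐ t ∂(volume.restrict (Ioo 0 T)), (fun x => F (x, t)) =ᵐ[volume.restrict Ω]
      timeEquiv Ω T hF.toLp t := by
  filter_upwards [timeEquiv_spec hF.toLp, ae_eq_slice_of_ae_eq restrict_cylinder hF.coeFn_toLp]
    with t h1 h2
  exact h2.symm.trans h1

theorem deriv_comp_prodMk {φ : Space d × ℝ → ℝ} (hφ : Differentiable ℝ φ) (p : Space d × ℝ) :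
    deriv (fun s => φ (p.1, s)) p.2 = fderiv ℝ φ p (0, 1) := by
  have h : HasDerivAt (fun s : ℝ => (p.1, s)) ((0 : Space d), (1 : ℝ)) p.2 :=
    (hasDerivAt_const _ _).prodMk (hasDerivAt_id _)
  exact ((hφ p).hasFDerivAt.comp_hasDerivAt p.2 h).deriv

theorem IsTestFunction.memLp_slice (hΩb : Bornology.IsBounded Ω) {U : Set (Space d × ℝ)}
    {φ : Space d × ℝ → ℝ} (hφ : IsTestFunction U φ) (t : ℝ) :
    MemLp (fun x => φ (x, t)) 2 (volume.restrict Ω) := by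
  have : IsFiniteMeasure ((volume : Measure (Space d)).restrict Ω) :=
    ⟨by simpa using hΩb.measure_lt_top⟩
  obtain ⟨C, hC⟩ := hφ.2.1.exists_bound_of_continuous hφ.continuous
  exact MemLp.of_bound (by have := hφ.continuous; fun_prop) C (ae_of_all _ fun x => hC _)

/-- The fundamental theorem of calculus for test functions, in `L²(Ω)`. -/
theorem IsTestFunction.integral_timeEquiv_fderiv (hΩb : Bornology.IsBounded Ω)
    {φ : Space d × ℝ → ℝ} (hφ : IsTestFunction (cylinder Ω T) φ) {t : ℝ} (ht : t ∈ Icc 0 T) :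
    ∫ s in 0..t, timeEquiv Ω T ((hφ.fderiv_apply ((0 : Space d), (1 : ℝ))).memLp.toLp) s
      = (hφ.memLp_slice hΩb t).toLp := by
  have : IsFiniteMeasure ((volume : Measure (Space d)).restrict Ω) :=
    ⟨by simpa using hΩb.measure_lt_top⟩
  have hψ := hφ.fderiv_apply ((0 : Space d), (1 : ℝ))
  set y := timeEquiv Ω T (hψ.memLp.toLp) with hy
  -- Testing with `ξ ∈ L²(Ω)` and applying Fubini reduces the claim to the scalar fundamental
  -- theorem at fixed `x`; there `φ(x, 0) = 0`, since the cylinder is open in time.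
  refine ext_inner_left ℝ fun ξ => ?_
  have h1 : inner ℝ ξ (∫ s in 0..t, y s) = ∫ s in 0..t, inner ℝ ξ (y s) :=
    ((innerSL ℝ ξ).intervalIntegral_comp_comm (y.intervalIntegrable ht)).symm
  have h2 : ∫ s in 0..t, inner ℝ ξ (y s)
      = ∫ s in Ioo 0 t, ∫ x in Ω, ξ x * fderiv ℝ φ (x, s) (0, 1) := by
    rw [intervalIntegral.integral_of_le ht.1, integral_Ioc_eq_integral_Ioo]
    refine integral_congr_ae (ae_restrict_of_ae_restrict_of_subset (Ioo_subset_Ioo_right ht.2) ?_)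
    filter_upwards [timeEquiv_toLp_eq hψ.memLp] with s hs
    rw [L2.inner_def]
    refine integral_congr_ae ?_
    filter_upwards [hs] with x hx
    rw [← hx]
    simp [mul_comm]
  have hint : Integrable (Function.uncurry fun (s : ℝ) (x : Space d) =>
      ξ x * fderiv ℝ φ (x, s) (0, 1))
      (((volume : Measure ℝ).restrict (Ioo 0 t)).prod (volume.restrict Ω)) := by
    obtain ⟨C, hC⟩ := hψ.2.1.exists_bound_of_continuous hψ.continuous
    have hξ : Integrable ξ (volume.restrict Ω) := (Lp.memLp ξ).integrable (by norm_num)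
    refine Integrable.mul_bdd (c := C) (hξ.comp_snd _) ?_ (ae_of_all _ fun p => hC (p.2, p.1))
    exact (hψ.continuous.comp continuous_swap).aestronglyMeasurable
  have h3 : ∀ x, ∫ s in Ioo 0 t, ξ x * fderiv ℝ φ (x, s) (0, 1) = ξ x * φ (x, t) := fun x => by
    rw [integral_const_mul, ← integral_Ioc_eq_integral_Ioo, ← intervalIntegral.integral_of_le ht.1,
      intervalIntegral.integral_eq_sub_of_hasDerivAt (f := fun s => φ (x, s))]
    · rw [hφ.eq_zero_of_notMem (x := (x, 0)) (by simp [cylinder]), sub_zero]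
    · intro s _
      have h : HasDerivAt (fun s : ℝ => (x, s)) ((0 : Space d), (1 : ℝ)) s :=
        (hasDerivAt_const _ _).prodMk (hasDerivAt_id _)
      exact (hφ.differentiable (x, s)).hasFDerivAt.comp_hasDerivAt s h
    · exact (hψ.continuous.comp (by fun_prop : Continuous fun s : ℝ => (x, s))).intervalIntegrable _ _
  rw [h1, h2, integral_integral_swap hint, L2.inner_def]
  refine integral_congr_ae ?_
  filter_upwards [(hφ.memLp_slice hΩb t).coeFn_toLp] with x hx
  rw [h3, hx]
  simp [mul_comm]

theorem integral_cylinder_mul_testFunction (v : L2Cyl Ω T) {φ : Space d × ℝ → ℝ}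
    (hφ : IsTestFunction (cylinder Ω T) φ) :
    ∫ p in cylinder Ω T, v p * φ p
      = inner ℝ (timeEquiv Ω T v) (timeEquiv Ω T hφ.memLp.toLp) := by
  rw [LinearIsometryEquiv.inner_map_map, L2.inner_def]
  refine integral_congr_ae ?_
  filter_upwards [hφ.memLp.coeFn_toLp (p := 2)] with p hp
  rw [hp]
  simp [mul_comm]

theorem isTimeDeriv_iff {v g : L2Cyl Ω T} : IsTimeDeriv v g ↔
    ∀ φ (hφ : IsTestFunction (cylinder Ω T) φ), inner ℝ (timeEquiv Ω T v)
      (timeEquiv Ω T (hφ.fderiv_apply ((0 : Space d), (1 : ℝ))).memLp.toLp)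
      = - inner ℝ (timeEquiv Ω T g) (timeEquiv Ω T hφ.memLp.toLp) := by
  refine forall₂_congr fun φ hφ => ?_
  rw [← integral_cylinder_mul_testFunction v (hφ.fderiv_apply _),
    ← integral_cylinder_mul_testFunction g hφ]
  simp_rw [deriv_comp_prodMk hφ.differentiable]

/-- Integration by parts of `g` against `∂ₜφ`: the primitive of `∂ₜφ` is `φ`, and the boundary term
vanishes because `φ(·, T) = 0`. -/
theorem isTimeDeriv_of_eq_volterra (hT : 0 ≤ T) (hΩb : Bornology.IsBounded Ω) {v g : L2Cyl Ω T}
    (h : timeEquiv Ω T v = volterra (timeEquiv Ω T g)) : IsTimeDeriv v g := by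
  rw [isTimeDeriv_iff]
  intro φ hφ
  have h1 := inner_volterra_add_inner_volterra hT (timeEquiv Ω T g)
    (timeEquiv Ω T (hφ.fderiv_apply ((0 : Space d), (1 : ℝ))).memLp.toLp)
  have h2 : totalIntegral hT (timeEquiv Ω T
      (hφ.fderiv_apply ((0 : Space d), (1 : ℝ))).memLp.toLp) = 0 := by
    rw [totalIntegral_apply, hφ.integral_timeEquiv_fderiv hΩb ⟨hT, le_rfl⟩]
    rw [Lp.eq_zero_iff_ae_eq_zero]
    filter_upwards [(hφ.memLp_slice hΩb T).coeFn_toLp] with x hx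
    rw [hx, hφ.eq_zero_of_notMem (by simp [cylinder])]
    rfl
  have h3 : volterra (timeEquiv Ω T (hφ.fderiv_apply ((0 : Space d), (1 : ℝ))).memLp.toLp)
      = timeEquiv Ω T hφ.memLp.toLp := by
    refine Lp.ext ?_
    filter_upwards [ae_restrict_mem measurableSet_Ioo, coeFn_volterra (timeEquiv Ω T
      (hφ.fderiv_apply ((0 : Space d), (1 : ℝ))).memLp.toLp), timeEquiv_toLp_eq hφ.memLp]
      with t ht h4 h5
    rw [h4, hφ.integral_timeEquiv_fderiv hΩb (Ioo_subset_Icc_self ht)]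
    exact Lp.ext ((hφ.memLp_slice hΩb t).coeFn_toLp.trans h5)
  rw [h2, h3, inner_zero_right] at h1
  rw [h]
  linarith

theorem hasZeroInitialValue_of_eq_volterra {v g : L2Cyl Ω T}
    (h : timeEquiv Ω T v = volterra (timeEquiv Ω T g)) : HasZeroInitialValue v := by
  refine ⟨fun t => ∫ s in 0..t, timeEquiv Ω T g s, (timeEquiv Ω T g).continuousOn_primitive, ?_,
    intervalIntegral.integral_same⟩
  filter_upwards [timeEquiv_spec v, coeFn_volterra (timeEquiv Ω T g)] with t h1 h2
  rwa [h, h2] at h1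

theorem IsTestFunction.mul_prod {ξ : Space d → ℝ} {η : ℝ → ℝ} (hξ : IsTestFunction Ω ξ)
    (hη : IsTestFunction (Ioo 0 T) η) :
    IsTestFunction (cylinder Ω T) fun p => ξ p.1 * η p.2 := by
  have hts : tsupport (fun p : Space d × ℝ => ξ p.1 * η p.2) ⊆ tsupport ξ ×ˢ tsupport η := by
    refine closure_minimal (fun p hp => ?_) ((isClosed_tsupport _).prod (isClosed_tsupport _))
    have hp' : ξ p.1 * η p.2 ≠ 0 := hp
    exact ⟨subset_tsupport _ (left_ne_zero_of_mul hp'), subset_tsupport _ (right_ne_zero_of_mul hp')⟩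
  exact ⟨(hξ.1.comp contDiff_fst).mul (hη.1.comp contDiff_snd),
    (hξ.2.1.isCompact.prod hη.2.1.isCompact).of_isClosed_subset (isClosed_tsupport _) hts,
    hts.trans (prod_mono hξ.2.2 hη.2.2)⟩

/-- The primitive of `g` has the same weak derivative as `v`. Tested with products `ξ(x) η(t)`, the
difference of the continuous representatives becomes a scalar function with zero weak derivative and
zero initial value, so the du Bois-Reymond lemma applies. -/
theorem IsTimeDeriv.eq_volterra (hT : 0 < T) (hΩ : IsOpen Ω) (hΩb : Bornology.IsBounded Ω)
    {v g : L2Cyl Ω T} (h : IsTimeDeriv v g) (h0 : HasZeroInitialValue v) :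
    timeEquiv Ω T v = volterra (timeEquiv Ω T g) := by
  obtain ⟨c, hc, hvc, hc0⟩ := h0
  have hG := (timeEquiv Ω T g).continuousOn_primitive
  have hcv : ∀ᵐ t ∂(volume.restrict (Ioo 0 T)), timeEquiv Ω T v t = c t := by
    filter_upwards [hvc, timeEquiv_spec v] with t h1 h2
    exact Lp.ext (h2.symm.trans h1)
  have hv' := isTimeDeriv_of_eq_volterra hT.le hΩb (v := (timeEquiv Ω T).symm
    (volterra (timeEquiv Ω T g))) (g := g) (by simp)
  rw [isTimeDeriv_iff] at h hv'
  have key : ∀ t ∈ Ioo 0 T, c t - ∫ s in 0..t, timeEquiv Ω T g s = 0 := by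
    intro t ht
    refine eq_zero_of_inner_testToLp hΩ fun ξ => ?_
    refine eqOn_zero_of_forall_integral_mul_deriv
      (a := fun t => inner ℝ (c t - ∫ s in 0..t, timeEquiv Ω T g s) (testToLp Ω ξ)) hT
      ((hc.sub hG).inner continuousOn_const) (by simp [hc0]) (fun η hη => ?_) t ht
    have hξ : IsTestFunction Ω ξ.1 := ξ.2
    have hφ := hξ.mul_prod hη
    have h1 := (h _ hφ).trans (hv' _ hφ).symm
    rw [LinearIsometryEquiv.apply_symm_apply, ← sub_eq_zero, ← inner_sub_left, L2.inner_def] at h1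
    refine Eq.trans (integral_congr_ae ?_) h1
    filter_upwards [hcv, coeFn_volterra (timeEquiv Ω T g), Lp.coeFn_sub (timeEquiv Ω T v)
      (volterra (timeEquiv Ω T g)), timeEquiv_toLp_eq (hφ.fderiv_apply (0, 1)).memLp]
      with s h2 h3 h4 h5
    rw [h4, Pi.sub_apply, h2, h3]
    have h6 : timeEquiv Ω T (hφ.fderiv_apply (0, 1)).memLp.toLp s
        = deriv η s • testToLp Ω ξ := by
      refine Lp.ext (h5.symm.trans ?_)
      refine EventuallyEq.trans ?_ (Lp.coeFn_smul _ _).symm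
      filter_upwards [ξ.2.memLp.coeFn_toLp (p := 2)] with x hx
      simp only [testToLp, LinearMap.coe_mk, AddHom.coe_mk, Pi.smul_apply, smul_eq_mul]
      rw [hx, ← deriv_comp_prodMk hφ.differentiable (x, s)]
      have h7 : HasDerivAt (fun s => ξ.1 x * η s) (ξ.1 x * deriv η s) s :=
        (hη.differentiable s).hasDerivAt.const_mul _
      exact h7.deriv.trans (mul_comm _ _)
    rw [h6, inner_smul_right, mul_comm]
  refine Lp.ext ?_
  filter_upwards [ae_restrict_mem measurableSet_Ioo, hcv, coeFn_volterra (timeEquiv Ω T g)]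
    with t ht h1 h2
  rw [h1, h2, ← sub_eq_zero, key t ht]

end TimeDerivative

/-! ### The heat operator on `V₀` -/

section HeatOperator

variable {d : ℕ} {Ω : Set (Space d)} {T : ℝ}

theorem isOpen_cylinder (hΩ : IsOpen Ω) : IsOpen (cylinder Ω T) := hΩ.prod isOpen_Ioo

theorem IsTimeDeriv.unique (hΩ : IsOpen Ω) {v g g' : L2Cyl Ω T} (h : IsTimeDeriv v g)
    (h' : IsTimeDeriv v g') : g = g' := by
  rw [← sub_eq_zero, Lp.eq_zero_iff_ae_eq_zero]
  refine ae_eq_zero_of_forall_integral_mul_testFunction (isOpen_cylinder hΩ) (Lp.memLp _)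
    fun φ hφ => ?_
  rw [integral_cylinder_mul_testFunction _ hφ, map_sub, inner_sub_left,
    ← integral_cylinder_mul_testFunction _ hφ, ← integral_cylinder_mul_testFunction _ hφ]
  linarith [h φ hφ, h' φ hφ]

theorem isSpaceLaplacian_iff {v z : L2Cyl Ω T} : IsSpaceLaplacian v z ↔
    ∀ᵐ t ∂(volume.restrict (Ioo 0 T)),
      IsWeakLaplacian Ω (timeEquiv Ω T v t) (timeEquiv Ω T z t) := by
  refine eventually_congr ?_
  filter_upwards [timeEquiv_spec v, timeEquiv_spec z] with t h1 h2
  exact ⟨fun h => h.congr h1 h2, fun h => h.congr h1.symm h2.symm⟩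

theorem IsSpaceLaplacian.unique (hΩ : IsOpen Ω) {v z z' : L2Cyl Ω T} (h : IsSpaceLaplacian v z)
    (h' : IsSpaceLaplacian v z') : z = z' := by
  rw [isSpaceLaplacian_iff] at h h'
  refine (timeEquiv Ω T).injective (Lp.ext ?_)
  filter_upwards [h, h'] with t h1 h2
  rw [← sub_eq_zero]
  refine eq_zero_of_inner_testToLp hΩ fun φ => ?_
  rw [inner_sub_left, inner_testToLp, inner_testToLp, ← h1 φ.1 φ.2, ← h2 φ.1 φ.2, sub_self]

theorem timeDeriv_eq (hΩ : IsOpen Ω) {v g : L2Cyl Ω T} (h : IsTimeDeriv v g) :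
    timeDeriv v = g := by
  have h' : ∃ g, IsTimeDeriv v g := ⟨g, h⟩
  rw [timeDeriv, dif_pos h']
  exact h'.choose_spec.unique hΩ h

theorem spaceLaplacian_eq (hΩ : IsOpen Ω) {v z : L2Cyl Ω T} (h : IsSpaceLaplacian v z) :
    spaceLaplacian v = z := by
  have h' : ∃ z, IsSpaceLaplacian v z := ⟨z, h⟩
  rw [spaceLaplacian, dif_pos h']
  exact h'.choose_spec.unique hΩ h

theorem MemHDelta.congr {w w' : Space d → ℝ} (h : MemHDelta Ω w)
    (hw : w =ᵐ[volume.restrict Ω] w') : MemHDelta Ω w' := by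
  obtain ⟨h1, z, hz, hwz⟩ := h
  exact ⟨h1.congr hw, z, hz, hwz.congr hw (ae_eq_refl _)⟩

/-- The pointwise action of the inverse of the Dirichlet Laplacian on `L²((0, T); L²(Ω))`. -/
def timeDirichletInverse (Ω : Set (Space d)) (T : ℝ) :
    L2Time (L2Space Ω) T →L[ℝ] L2Time (L2Space Ω) T :=
  (dirichletInverse Ω).compLpL 2 ((volume : Measure ℝ).restrict (Ioo 0 T))

theorem coeFn_timeDirichletInverse (y : L2Time (L2Space Ω) T) :
    ∀ᵐ t ∂(volume.restrict (Ioo 0 T)), timeDirichletInverse Ω T y t = dirichletInverse Ω (y t) :=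
  (dirichletInverse Ω).coeFn_compLpL y

theorem IsSpaceLaplacian.eq_timeDirichletInverse (hd : 0 < d) (hΩb : Bornology.IsBounded Ω)
    {v z : L2Cyl Ω T} (hv : MemL2HDelta v) (h : IsSpaceLaplacian v z) :
    timeEquiv Ω T v = timeDirichletInverse Ω T (timeEquiv Ω T (-z)) := by
  rw [isSpaceLaplacian_iff] at h
  refine Lp.ext ?_
  filter_upwards [h, hv.1, timeEquiv_spec v, coeFn_timeDirichletInverse (timeEquiv Ω T (-z)),
    Lp.coeFn_neg (timeEquiv Ω T z)] with t h1 h2 h3 h4 h5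
  rw [h4, map_neg, h5]
  exact eq_dirichletInverse_of_isWeakLaplacian hd hΩb (h2.1.congr h3) h1

theorem isSpaceLaplacian_of_eq_timeDirichletInverse (hd : 0 < d) (hΩb : Bornology.IsBounded Ω)
    {v z : L2Cyl Ω T} (h : timeEquiv Ω T v = timeDirichletInverse Ω T (timeEquiv Ω T z)) :
    MemL2HDelta v ∧ IsSpaceLaplacian v (-z) := by
  have h0 : IsSpaceLaplacian v (-z) := by
    rw [isSpaceLaplacian_iff]
    filter_upwards [coeFn_timeDirichletInverse (timeEquiv Ω T z),
      Lp.coeFn_neg (timeEquiv Ω T z)] with t h1 h2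
    rw [h, h1, map_neg, h2]
    exact isWeakLaplacian_dirichletInverse hd hΩb _
  refine ⟨⟨?_, _, h0⟩, h0⟩
  filter_upwards [timeEquiv_spec v, coeFn_timeDirichletInverse (timeEquiv Ω T z)] with t h1 h2
  rw [h, h2] at h1
  exact (memHDelta_dirichletInverse hd hΩb _).congr h1.symm

/-! ### The degenerate case of dimension zero -/

theorem laplacian_eq_zero_of_dim_zero {φ : Space 0 → ℝ} (hφ : ContDiff ℝ ∞ φ) : Δ φ = 0 := by
  ext x
  rw [laplacian_apply φ (contDiff_infty.1 hφ 2)]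
  simp

theorem memHDelta_of_dim_zero {Ω : Set (Space 0)} (hΩ : IsOpen Ω) (w : L2Space Ω) :
    MemHDelta Ω w := by
  have hz : IsWeakLaplacian Ω w 0 := fun φ hφ => by
    rw [laplacian_eq_zero_of_dim_zero hφ.1]; simp
  refine ⟨⟨Lp.memLp w, 0, MemLp.zero, fun φ _ => Subsingleton.elim _ _,
    -- On a one-point space every function is smooth with compact support; the indicator puts the
    -- support inside `Ω` even when `Ω` is empty.
    fun _ => indicator Ω w, fun _ => ⟨?_, (isClosed_tsupport _).isCompact, ?_⟩, ?_, ?_⟩, 0, MemLp.zero, hz⟩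
  · rw [show indicator Ω w = fun _ => indicator Ω w 0 from
      funext fun x => by rw [Subsingleton.elim x 0]]
    exact contDiff_const
  · rw [tsupport, (isClosed_discrete _).closure_eq]
    exact support_indicator_subset
  · refine tendsto_const_nhds.congr fun _ => ?_
    rw [← eLpNorm_zero (ε := ℝ) (p := 2) (μ := volume.restrict Ω)]
    refine eLpNorm_congr_ae ?_
    filter_upwards [ae_restrict_mem hΩ.measurableSet] with x hx
    simp [hx]
  · refine tendsto_const_nhds.congr fun _ => ?_
    rw [← eLpNorm_zero (ε := Space 0) (p := 2) (μ := volume.restrict Ω)]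
    exact eLpNorm_congr_ae (ae_of_all _ fun x => Subsingleton.elim _ _)

theorem isSpaceLaplacian_zero_of_dim_zero {Ω : Set (Space 0)} (v : L2Cyl Ω T) :
    IsSpaceLaplacian v 0 := by
  rw [isSpaceLaplacian_iff, map_zero]
  filter_upwards [Lp.coeFn_zero (L2Space Ω) 2 (volume.restrict (Ioo 0 T))] with t h1 φ hφ
  rw [laplacian_eq_zero_of_dim_zero hφ.1, h1]
  refine Eq.trans (by simp) (integral_congr_ae (f := fun _ => (0 : ℝ)) ?_)
  filter_upwards [Lp.coeFn_zero ℝ 2 (volume.restrict Ω)] with x hx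
  simp only [Pi.zero_apply] at hx ⊢
  rw [hx, zero_mul]

theorem timeDirichletInverse_accretive (hΩ : IsOpen Ω) (hd : 0 < d)
    (hΩb : Bornology.IsBounded Ω) (y : L2Time (L2Space Ω) T)
    (hy : inner ℝ (timeDirichletInverse Ω T y) y ≤ 0) : y = 0 :=
  eq_zero_of_inner_compLpL_nonpos inner_dirichletInverse_self_nonneg
    (fun _ => eq_zero_of_inner_dirichletInverse_self hΩ hd hΩb) y hy

/-- The heat equation with homogeneous initial and boundary values is solvable in `V₀`. -/
theorem exists_mem_V0_heat_eq (hT : 0 < T) (hΩ : IsOpen Ω) (hΩb : Bornology.IsBounded Ω)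
    (f : L2Cyl Ω T) :
    ∃ u ∈ V0 Ω T, ∃ g z, IsTimeDeriv u g ∧ IsSpaceLaplacian u z ∧ g - z = f := by
  rcases Nat.eq_zero_or_pos d with rfl | hd
  · have hu : timeEquiv Ω T ((timeEquiv Ω T).symm (volterra (timeEquiv Ω T f)))
        -- With no spatial directions the Laplacian is zero and the equation is `∂ₜ u = f`.
        = volterra (timeEquiv Ω T f) := by simp
    have hg := isTimeDeriv_of_eq_volterra hT.le hΩb hu
    refine ⟨_, ⟨⟨?_, 0, isSpaceLaplacian_zero_of_dim_zero _⟩, ⟨f, hg⟩,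
      hasZeroInitialValue_of_eq_volterra hu⟩, f, 0, hg, isSpaceLaplacian_zero_of_dim_zero _,
      sub_zero f⟩
    filter_upwards [timeEquiv_spec ((timeEquiv Ω T).symm (volterra (timeEquiv Ω T f)))] with t h1
    exact (memHDelta_of_dim_zero hΩ _).congr h1.symm
  · obtain ⟨g, z, hgz, hf⟩ := exists_add_eq_of_commute (S := timeDirichletInverse Ω T)
      (J := volterra) (compLpL_volterra (dirichletInverse Ω))
      (timeDirichletInverse_accretive hΩ hd hΩb) (inner_volterra_self_nonneg hT.le)
      (inner_compLpL_volterra_nonneg hT.le inner_dirichletInverse_comm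
        inner_dirichletInverse_self_nonneg) (timeEquiv Ω T f)
    have hu : timeEquiv Ω T ((timeEquiv Ω T).symm (volterra g))
        = volterra (timeEquiv Ω T ((timeEquiv Ω T).symm g)) := by simp
    have hu' : timeEquiv Ω T ((timeEquiv Ω T).symm (volterra g))
        = timeDirichletInverse Ω T (timeEquiv Ω T ((timeEquiv Ω T).symm z)) := by simp [hgz]
    have hg := isTimeDeriv_of_eq_volterra hT.le hΩb hu
    obtain ⟨h1, h2⟩ := isSpaceLaplacian_of_eq_timeDirichletInverse hd hΩb hu'
    refine ⟨_, ⟨h1, ⟨_, hg⟩, hasZeroInitialValue_of_eq_volterra hu⟩, _, _, hg, h2, ?_⟩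
    rw [sub_neg_eq_add, ← map_add, hf, LinearIsometryEquiv.symm_apply_apply]

/-- Solutions of the heat equation in `V₀` are unique. -/
theorem eq_of_heat_eq (hT : 0 < T) (hΩ : IsOpen Ω) (hΩb : Bornology.IsBounded Ω)
    {u u' g g' z z' : L2Cyl Ω T} (hu : u ∈ V0 Ω T) (hu' : u' ∈ V0 Ω T) (hg : IsTimeDeriv u g)
    (hg' : IsTimeDeriv u' g') (hz : IsSpaceLaplacian u z) (hz' : IsSpaceLaplacian u' z')
    (h : g - z = g' - z') : u = u' := by
  have hJ := hg.eq_volterra hT hΩ hΩb hu.2.2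
  have hJ' := hg'.eq_volterra hT hΩ hΩb hu'.2.2
  suffices hgg : timeEquiv Ω T g = timeEquiv Ω T g' from
    (timeEquiv Ω T).injective (by rw [hJ, hJ', hgg])
  rcases Nat.eq_zero_or_pos d with rfl | hd
  · rw [hz.unique hΩ (isSpaceLaplacian_zero_of_dim_zero u),
      hz'.unique hΩ (isSpaceLaplacian_zero_of_dim_zero u'), sub_zero, sub_zero] at h
    rw [h]
  · have hS := hz.eq_timeDirichletInverse hd hΩb hu.1
    have hS' := hz'.eq_timeDirichletInverse hd hΩb hu'.1
    rw [← sub_eq_zero]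
    -- Applied to the differences of the time derivatives and of the negative Laplacians.
    refine eq_zero_of_add_eq_zero (S := timeDirichletInverse Ω T) (J := volterra)
      (z := timeEquiv Ω T (-z) - timeEquiv Ω T (-z'))
      (timeDirichletInverse_accretive hΩ hd hΩb) (inner_volterra_self_nonneg hT.le) ?_ ?_
    · rw [map_sub, map_sub, ← hJ, ← hJ', ← hS, ← hS']
    · rw [← map_sub, ← map_sub, ← map_add, ← map_zero (timeEquiv Ω T)]
      congr 1
      rw [← sub_eq_zero.2 h]
      abel

/-! ### The residual and the two problems -/

/-- The residual `∂ₜ v - Δ v`. -/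
def heatOperator (v : L2Cyl Ω T) : L2Cyl Ω T := timeDeriv v - spaceLaplacian v

theorem exists_heatOperator_eq (hT : 0 < T) (hΩ : IsOpen Ω) (hΩb : Bornology.IsBounded Ω)
    (f : L2Cyl Ω T) : ∃ u ∈ V0 Ω T, heatOperator u = f := by
  obtain ⟨u, hu, g, z, hg, hz, hf⟩ := exists_mem_V0_heat_eq hT hΩ hΩb f
  exact ⟨u, hu, by rw [heatOperator, timeDeriv_eq hΩ hg, spaceLaplacian_eq hΩ hz, hf]⟩

theorem injOn_heatOperator (hT : 0 < T) (hΩ : IsOpen Ω) (hΩb : Bornology.IsBounded Ω) :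
    InjOn (heatOperator (Ω := Ω) (T := T)) (V0 Ω T) := by
  intro u hu u' hu' h
  obtain ⟨g, hg⟩ := hu.2.1
  obtain ⟨g', hg'⟩ := hu'.2.1
  obtain ⟨z, hz⟩ := hu.1.2
  obtain ⟨z', hz'⟩ := hu'.1.2
  refine eq_of_heat_eq hT hΩ hΩb hu hu' hg hg' hz hz' ?_
  rwa [heatOperator, heatOperator, timeDeriv_eq hΩ hg, timeDeriv_eq hΩ hg',
    spaceLaplacian_eq hΩ hz, spaceLaplacian_eq hΩ hz'] at h

theorem integral_integral_eq_inner (hT : 0 ≤ T) (a b : L2Cyl Ω T) {F : Space d × ℝ → ℝ}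
    (hF : F =ᵐ[volume.restrict (cylinder Ω T)] fun p => a p * b p) :
    ∫ t in (0 : ℝ)..T, ∫ x in Ω, F (x, t) = inner ℝ a b := by
  have h1 : (fun p => inner ℝ (a p) (b p)) =ᵐ[volume.restrict (cylinder Ω T)] F := by
    filter_upwards [hF] with p hp
    rw [hp]; simp [mul_comm]
  have hi : Integrable F (volume.restrict (cylinder Ω T)) :=
    (L2.integrable_inner (𝕜 := ℝ) a b).congr h1
  rw [L2.inner_def, integral_congr_ae h1, restrict_cylinder,
    integral_prod_symm F (restrict_cylinder (Ω := Ω) (T := T) ▸ hi),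
    intervalIntegral.integral_of_le hT, integral_Ioc_eq_integral_Ioo]

theorem bilinA_eq_inner (hT : 0 ≤ T) (v w : L2Cyl Ω T) :
    bilinA v w = inner ℝ (heatOperator v) (heatOperator w) := by
  refine integral_integral_eq_inner hT _ _ (F := fun p => timeDeriv v p * timeDeriv w p
      + spaceLaplacian v p * spaceLaplacian w p - timeDeriv v p * spaceLaplacian w p
      - spaceLaplacian v p * timeDeriv w p) ?_
  filter_upwards [Lp.coeFn_sub (timeDeriv v) (spaceLaplacian v),
    Lp.coeFn_sub (timeDeriv w) (spaceLaplacian w)] with p h1 h2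
  rw [heatOperator, heatOperator, h1, h2, Pi.sub_apply, Pi.sub_apply]
  ring

theorem linF_eq_inner (hT : 0 ≤ T) (f w : L2Cyl Ω T) :
    linF f w = inner ℝ f (heatOperator w) := by
  refine integral_integral_eq_inner hT _ _
    (F := fun p => f p * (timeDeriv w p - spaceLaplacian w p)) ?_
  filter_upwards [Lp.coeFn_sub (timeDeriv w) (spaceLaplacian w)] with p h2
  rw [heatOperator, h2, Pi.sub_apply]

/-- Because `heatOperator` is onto, the functional attains zero, so its minimizers are its zeros. -/
theorem isLSMinimizer_iff (hT : 0 < T) (hΩ : IsOpen Ω) (hΩb : Bornology.IsBounded Ω)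
    (f u : L2Cyl Ω T) : IsLSMinimizer f u ↔ u ∈ V0 Ω T ∧ heatOperator u = f := by
  refine and_congr_right fun _ => ⟨fun h => ?_, fun h v _ => ?_⟩
  · obtain ⟨v, hv, hvf⟩ := exists_heatOperator_eq hT hΩ hΩb f
    have h1 := h v hv
    rw [lsFunctional, lsFunctional, ← heatOperator, ← heatOperator, hvf, sub_self] at h1
    have h2 : ‖heatOperator u - f‖ ^ 2 = 0 := le_antisymm (by
      rw [norm_zero] at h1; linarith) (sq_nonneg _)
    exact sub_eq_zero.1 (norm_eq_zero.1 (pow_eq_zero_iff two_ne_zero |>.1 h2))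
  · rw [lsFunctional, lsFunctional, ← heatOperator, h, sub_self]
    have := sq_nonneg ‖timeDeriv v - spaceLaplacian v - f‖
    rw [norm_zero]
    linarith

theorem isVariationalSolution_iff (hT : 0 < T) (hΩ : IsOpen Ω) (hΩb : Bornology.IsBounded Ω)
    (f u : L2Cyl Ω T) : IsVariationalSolution f u ↔ u ∈ V0 Ω T ∧ heatOperator u = f := by
  refine and_congr_right fun _ => ⟨fun h => ?_, fun h v _ => ?_⟩
  -- The test function is chosen so that the equation reads `‖heatOperator u - f‖² = 0`.
  · obtain ⟨v, hv, hvf⟩ := exists_heatOperator_eq hT hΩ hΩb (heatOperator u - f)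
    have h1 := h v hv
    rw [bilinA_eq_inner hT.le, linF_eq_inner hT.le, hvf, ← sub_eq_zero, ← inner_sub_left,
      inner_self_eq_zero] at h1
    exact sub_eq_zero.1 h1
  · rw [bilinA_eq_inner hT.le, linF_eq_inner hT.le, h]

theorem existsUnique_heatOperator_eq (hT : 0 < T) (hΩ : IsOpen Ω) (hΩb : Bornology.IsBounded Ω)
    (f : L2Cyl Ω T) : ∃! u, u ∈ V0 Ω T ∧ heatOperator u = f := by
  obtain ⟨u, hu, hf⟩ := exists_heatOperator_eq hT hΩ hΩb f
  exact ⟨u, ⟨hu, hf⟩, fun v hv => injOn_heatOperator hT hΩ hΩb hv.1 hu (hv.2.trans hf.symm)⟩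

end HeatOperator

end

end HeatLS

theorem mainTheorem4 (d : ℕ) (Ω : Set (HeatLS.Space d)) (hΩ : IsOpen Ω)
    (hΩb : Bornology.IsBounded Ω) (T : ℝ) (hT : 0 < T) (f : HeatLS.L2Cyl Ω T) :
    (∀ u : HeatLS.L2Cyl Ω T, HeatLS.IsLSMinimizer f u ↔ HeatLS.IsVariationalSolution f u) ∧
    (∃! u : HeatLS.L2Cyl Ω T, HeatLS.IsLSMinimizer f u) ∧
    (∃! u : HeatLS.L2Cyl Ω T, HeatLS.IsVariationalSolution f u) := by
  refine ⟨fun u => (HeatLS.isLSMinimizer_iff hT hΩ hΩb f u).trans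
    (HeatLS.isVariationalSolution_iff hT hΩ hΩb f u).symm, ?_, ?_⟩
  · simpa only [HeatLS.isLSMinimizer_iff hT hΩ hΩb] using
      HeatLS.existsUnique_heatOperator_eq hT hΩ hΩb f
  · simpa only [HeatLS.isVariationalSolution_iff hT hΩ hΩb] using
      HeatLS.existsUnique_heatOperator_eq hT hΩ hΩb f
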